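/- Let $n=2m+1$ with $m\ge 1$, and let $M$ be a closed (compact, without boundary) oriented $n$-dimensional Riemannian manifold with a fixed spin structure. Let $S(M)$ be its complex spinor bundle, associated with the irreducible complex representation $S$ of dimension $2^m$ of the Clifford algebra $C(n)$ (generators $c_i$, relations $c_ic_j+c_jc_i=-2\delta_{ij}$) on which $(\sqrt{-1})^{m+1}c_1\cdots c_n$ is the identity, and let $\nabla^S$ be the connection induced on it by the Levi-Civita connection $\nabla$. Extend $\nabla^S$ to $S(M)\otimes\mathbb C^N$ by the trivial connection on $\mathbb C^N$. For a local oriented orthonormal frame $e_1,\dots,e_n$ of $TM$ with dual frame $e^1,\dots,e^n$ let $D=\sum_i c(e^i)\nabla^S_{e_i}$ be the Dirac operator on $\Gamma(S(M)\otimes\mathbb C^N)$. Let $g:M\to U(N)$ be smooth, acting on $S(M)\otimes\mathbb C^N$ as $\mathrm{Id}\otimes g$, and for $u\in\mathbb R$ (in particular $u\in[0,1]$) put $$D_u=(1-u)D+u\,g^{-1}Dg .$$ Let $\omega=g^{-1}dg$ be the associated matrix-valued one-form. Then, on smooth sections of $S(M)\otimes\mathbb C^N$, $$D_u^2=-\Delta+\frac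 K4+u^2c(\omega^2)+u\bigl(-2\,\iota(\omega^*)\nabla^S+c(d\omega)+d^*\omega\bigr),\qquad \dot D_u=\frac{d}{du}D_u=c(\omega).$$ Here $\Delta=\sum_i\bigl(\nabla^S_{e_i}\nabla^S_{e_i}-\nabla^S_{\nabla_{e_i}e_i}\bigr)$, $K$ is the scalar curvature of $M$, $c(\omega)=\sum_i c(e^i)\,\omega(e_i)$, $c(\omega^2)=\sum_{i,j}c(e^i)c(e^j)\,\omega(e_i)\omega(e_j)=c(\omega)^2$, $\iota(\omega^*)\nabla^S=\sum_i\omega(e_i)\nabla^S_{e_i}$, $c(d\omega)=\sum_{i<j}c(e^i)c(e^j)\,d\omega(e_i,e_j)$ and $d^*\omega=-\sum_i(\nabla_{e_i}\omega)(e_i)$. -/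

import Mathlib

open scoped Manifold ContDiff
open Bundle

noncomputable section

/-! ### Clifford algebra, Spin group and the spinor module -/

/-- The negative definite form `x ↦ -(x₁² + ⋯ + xₙ²)` on `ℝⁿ`, so that vectors satisfy
`x * x = -|x|²` in the Clifford algebra. -/
def negForm (n : ℕ) : QuadraticForm ℝ (Fin n → ℝ) :=
  QuadraticMap.weightedSumSquares ℝ (fun _ : Fin n => (-1 : ℝ))

/-- The Clifford algebra `C(n)`. -/
abbrev Cl (n : ℕ) : Type := CliffordAlgebra (negForm n)

/-- The generator `cᵢ` of `C(n)` given by the `i`-th standard basis vector. -/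
def gen {n : ℕ} (i : Fin n) : Cl n := CliffordAlgebra.ι (negForm n) (Pi.single i 1)

/-- The group `Spin(n) ⊆ C(n)`. -/
abbrev Spin (n : ℕ) : Type := spinGroup (negForm n)

/-- `S` is the complex spinor representation of `C(2m+1)`: the irreducible complex representation
of dimension `2^m` on which the chirality operator `Γ = (√-1)^(m+1) c₁ ⋯ c_{2m+1}` is the
identity. -/
structure SpinorModule (m : ℕ) (S : Type*) [AddCommGroup S] [Module ℂ S] where
  /-- The action of the Clifford algebra. -/
  rho : Cl (2 * m + 1) →ₐ[ℝ] Module.End ℂ S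
  finrank_eq : Module.finrank ℂ S = 2 ^ m
  irreducible : ∀ W : Submodule ℂ S, (∀ a : Cl (2 * m + 1), ∀ w ∈ W, rho a w ∈ W) →
    W = ⊥ ∨ W = ⊤
  chirality : Complex.I ^ (m + 1) •
    (List.ofFn (fun i : Fin (2 * m + 1) => rho (gen i))).prod = 1

/-! ### Riemannian metrics and spin structures -/

/-- A smooth Riemannian metric on the tangent bundle of an `n`-manifold `M`. -/
abbrev RiemMetric (n : ℕ) (M : Type*) [TopologicalSpace M]
    [ChartedSpace (EuclideanSpace ℝ (Fin n)) M] [IsManifold (𝓡 n) ∞ M] : Type _ :=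
  ContMDiffRiemannianMetric (𝓡 n) ∞ (EuclideanSpace ℝ (Fin n))
    (fun x : M => TangentSpace (𝓡 n) x)

/-- An orientation together with a spin structure on a Riemannian manifold: an open cover
`(U_α)` with smooth orthonormal frames `e^α` of `TM` over `U_α`, and smooth maps
`h_{αβ} : U_α ∩ U_β → Spin(n)` which satisfy the cocycle condition and lift the transition
functions of the frames, i.e. `e^β_k = ∑ₗ Aₗₖ e^α_l` where `A = Ad(h_{αβ}) ∈ SO(n)`.
Smoothness of a map into (the finite dimensional space) `C(n)` is smoothness of
all its components. The values of all data outside of their domains are irrelevant. -/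
structure SpinStructure {n : ℕ} {M : Type*} [TopologicalSpace M]
    [ChartedSpace (EuclideanSpace ℝ (Fin n)) M] [IsManifold (𝓡 n) ∞ M]
    (G : RiemMetric n M) (ι : Type*) where
  dom : ι → Set M
  isOpen_dom : ∀ α, IsOpen (dom α)
  cover : ∀ x : M, ∃ α, x ∈ dom α
  frame : ι → Fin n → (x : M) → TangentSpace (𝓡 n) x
  frame_smooth : ∀ α k, ContMDiffOn (𝓡 n) ((𝓡 n).prod 𝓘(ℝ, EuclideanSpace ℝ (Fin n))) ∞
    (fun x => (TotalSpace.mk' (EuclideanSpace ℝ (Fin n)) x (frame α k x) :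
      TotalSpace (EuclideanSpace ℝ (Fin n)) (fun x : M => TangentSpace (𝓡 n) x))) (dom α)
  orthonormal : ∀ α, ∀ x ∈ dom α, ∀ i j,
    G.inner x (frame α i x) (frame α j x) = if i = j then 1 else 0
  lift : ι → ι → M → Spin n
  lift_smooth : ∀ α β, ∀ φ : Cl n →ₗ[ℝ] ℝ, ContMDiffOn (𝓡 n) 𝓘(ℝ, ℝ) ∞
    (fun x => φ (lift α β x : Cl n)) (dom α ∩ dom β)
  lift_frame : ∀ α β, ∀ x ∈ dom α ∩ dom β, ∀ k,
    (lift α β x : Cl n) * gen k * (((lift α β x)⁻¹ : Spin n) : Cl n) =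
      ∑ l, G.inner x (frame α l x) (frame β k x) • (gen l : Cl n)
  cocycle : ∀ α β γ, ∀ x ∈ dom α ∩ dom β ∩ dom γ,
    lift α β x * lift β γ x = lift α γ x

/-- A smooth section of `S(M) ⊗ ℂ^N`, where `S(M)` is the spinor bundle, i.e. the vector bundle
with fibre `S` and transition functions `rho (h_{αβ})`. The section is given by its smooth
components `ψ_α : U_α → S ⊗ ℂ^N = S^N`, which satisfy `ψ_α = rho (h_{αβ}) ψ_β` on overlaps. -/
structure SpinorField {m : ℕ} {M : Type*} [TopologicalSpace M]
    [ChartedSpace (EuclideanSpace ℝ (Fin (2 * m + 1))) M] [IsManifold (𝓡 (2 * m + 1)) ∞ M]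
    {G : RiemMetric (2 * m + 1) M} {ι : Type*} (P : SpinStructure G ι)
    {S : Type*} [NormedAddCommGroup S] [NormedSpace ℂ S] (σ : SpinorModule m S) (N : ℕ) where
  toFun : ι → M → (Fin N → S)
  smooth : ∀ α, ContMDiffOn (𝓡 (2 * m + 1)) 𝓘(ℝ, Fin N → S) ∞ (toFun α) (P.dom α)
  compat : ∀ α β, ∀ x ∈ P.dom α ∩ P.dom β, ∀ a,
    toFun α x a = σ.rho (P.lift α β x : Cl (2 * m + 1)) (toFun β x a)

/-! ### Levi-Civita connection and scalar curvature, in a local orthonormal frame `e` -/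

section Geometry

variable {n : ℕ} {M : Type*} [TopologicalSpace M]
  [ChartedSpace (EuclideanSpace ℝ (Fin n)) M] [IsManifold (𝓡 n) ∞ M]

/-- Vector fields, without regularity. -/
abbrev VField (n : ℕ) (M : Type*) [TopologicalSpace M]
    [ChartedSpace (EuclideanSpace ℝ (Fin n)) M] : Type _ :=
  (x : M) → TangentSpace (𝓡 n) x

/-- The coefficients `⟨∇_{eᵢ} eⱼ, eₖ⟩` of the Levi-Civita connection in an orthonormal frame,
by the Koszul formula. -/
def leviCivitaCoeff (G : RiemMetric n M) (e : Fin n → VField n M) (i j k : Fin n) (x : M) : ℝ :=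
  (1 / 2 : ℝ) * (G.inner x (VectorField.mlieBracket (𝓡 n) (e i) (e j) x) (e k x)
    - G.inner x (VectorField.mlieBracket (𝓡 n) (e j) (e k) x) (e i x)
    + G.inner x (VectorField.mlieBracket (𝓡 n) (e k) (e i) x) (e j x))

/-- The Levi-Civita connection `∇_X Y = ∑ₖ (X⟨Y, eₖ⟩ + ∑ᵢⱼ ⟨X, eᵢ⟩ ⟨Y, eⱼ⟩ ⟨∇_{eᵢ} eⱼ, eₖ⟩) eₖ`. -/
def leviCivita (G : RiemMetric n M) (e : Fin n → VField n M) (X Y : VField n M) : VField n M :=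
  fun x => ∑ k, (mvfderiv (𝓡 n) (fun y => G.inner y (Y y) (e k y)) x (X x)
    + ∑ i, ∑ j, G.inner x (X x) (e i x) * G.inner x (Y x) (e j x)
        * leviCivitaCoeff G e i j k x) • e k x

/-- The Riemann curvature `R(X,Y)Z = ∇_X ∇_Y Z - ∇_Y ∇_X Z - ∇_{[X,Y]} Z`. -/
def curvature (G : RiemMetric n M) (e : Fin n → VField n M) (X Y Z : VField n M) : VField n M :=
  fun x => leviCivita G e X (leviCivita G e Y Z) x - leviCivita G e Y (leviCivita G e X Z) x
    - leviCivita G e (VectorField.mlieBracket (𝓡 n) X Y) Z x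

/-- The scalar curvature `K = ∑ᵢⱼ ⟨R(eᵢ, eⱼ) eⱼ, eᵢ⟩` (positive on round spheres). -/
def scalarCurvature (G : RiemMetric n M) (e : Fin n → VField n M) (x : M) : ℝ :=
  ∑ i, ∑ j, G.inner x (curvature G e (e i) (e j) (e j) x) (e i x)

/-! ### The matrix-valued one-form `ω = g⁻¹ dg` -/

variable {N : ℕ}

/-- The differential, entry by entry, of a matrix-valued function `A`, in the direction `X`. -/
def matDeriv (A : M → Matrix (Fin N) (Fin N) ℂ) (X : VField n M) :
    M → Matrix (Fin N) (Fin N) ℂ :=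
  fun x a b => mvfderiv (𝓡 n) (fun y => A y a b) x (X x)

/-- The function `ω(X) = g⁻¹ dg(X)`. -/
def omega (g : M → Matrix.unitaryGroup (Fin N) ℂ) (X : VField n M) :
    M → Matrix (Fin N) (Fin N) ℂ :=
  fun x => ((g x)⁻¹ : Matrix.unitaryGroup (Fin N) ℂ).val *
    matDeriv (fun y => (g y).val) X x

/-- The exterior derivative `dω(X,Y) = X(ω(Y)) - Y(ω(X)) - ω([X,Y])`. -/
def dOmega (g : M → Matrix.unitaryGroup (Fin N) ℂ) (X Y : VField n M) :
    M → Matrix (Fin N) (Fin N) ℂ :=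
  fun x => matDeriv (omega g Y) X x - matDeriv (omega g X) Y x
    - omega g (VectorField.mlieBracket (𝓡 n) X Y) x

/-- The codifferential `d^*ω = -∑ᵢ (∇_{eᵢ} ω)(eᵢ) = -∑ᵢ (eᵢ(ω(eᵢ)) - ω(∇_{eᵢ} eᵢ))`. -/
def codiffOmega (G : RiemMetric n M) (e : Fin n → VField n M)
    (g : M → Matrix.unitaryGroup (Fin N) ℂ) : M → Matrix (Fin N) (Fin N) ℂ :=
  fun x => -∑ i, (matDeriv (omega g (e i)) (e i) x - omega g (leviCivita G e (e i) (e i)) x)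

end Geometry

/-! ### Operators on the components `ψ : U_α → S ⊗ ℂ^N` of spinor fields in a frame `e` -/

section Operators

variable {m : ℕ} {M : Type*} [TopologicalSpace M]
  [ChartedSpace (EuclideanSpace ℝ (Fin (2 * m + 1))) M] [IsManifold (𝓡 (2 * m + 1)) ∞ M]
  {S : Type*} [NormedAddCommGroup S] [NormedSpace ℂ S] {N : ℕ}

/-- The action `Id_S ⊗ A` of a matrix on `S ⊗ ℂ^N = S^N`. -/
def matAct (A : Matrix (Fin N) (Fin N) ℂ) (v : Fin N → S) : Fin N → S :=
  fun a => ∑ b, A a b • v b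

/-- The Clifford multiplication `c(eⁱ) ⊗ Id` on `S ⊗ ℂ^N = S^N`. -/
def cliff (σ : SpinorModule m S) (i : Fin (2 * m + 1)) (v : Fin N → S) : Fin N → S :=
  fun a => σ.rho (gen i) (v a)

/-- The connection on `S(M) ⊗ ℂ^N` induced by the Levi-Civita connection and the trivial
connection: `∇_X ψ = X(ψ) + (1/4) ∑ⱼₖ ⟨∇_X eⱼ, eₖ⟩ c(eʲ) c(eᵏ) ψ`. -/
def spinConn (G : RiemMetric (2 * m + 1) M) (σ : SpinorModule m S)
    (e : Fin (2 * m + 1) → VField (2 * m + 1) M) (X : VField (2 * m + 1) M)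
    (ψ : M → Fin N → S) : M → Fin N → S :=
  fun x => mvfderiv (𝓡 (2 * m + 1)) ψ x (X x)
    + (1 / 4 : ℝ) • ∑ j, ∑ k, G.inner x (leviCivita G e X (e j) x) (e k x) •
        cliff σ j (cliff σ k (ψ x))

/-- The Dirac operator `D = ∑ᵢ c(eⁱ) ∇_{eᵢ}`. -/
def dirac (G : RiemMetric (2 * m + 1) M) (σ : SpinorModule m S)
    (e : Fin (2 * m + 1) → VField (2 * m + 1) M) (ψ : M → Fin N → S) : M → Fin N → S :=
  fun x => ∑ i, cliff σ i (spinConn G σ e (e i) ψ x)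

/-- The deformed Dirac operator `D_u = (1 - u) D + u g⁻¹ D g`. -/
def diracU (G : RiemMetric (2 * m + 1) M) (σ : SpinorModule m S)
    (e : Fin (2 * m + 1) → VField (2 * m + 1) M)
    (g : M → Matrix.unitaryGroup (Fin N) ℂ) (u : ℝ) (ψ : M → Fin N → S) : M → Fin N → S :=
  fun x => (1 - u) • dirac G σ e ψ x
    + u • matAct ((g x)⁻¹ : Matrix.unitaryGroup (Fin N) ℂ).val
        (dirac G σ e (fun y => matAct (g y).val (ψ y)) x)

/-- The connection Laplacian `Δ = ∑ᵢ (∇_{eᵢ} ∇_{eᵢ} - ∇_{∇_{eᵢ} eᵢ})`. -/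
def connLaplacian (G : RiemMetric (2 * m + 1) M) (σ : SpinorModule m S)
    (e : Fin (2 * m + 1) → VField (2 * m + 1) M) (ψ : M → Fin N → S) : M → Fin N → S :=
  fun x => ∑ i, (spinConn G σ e (e i) (spinConn G σ e (e i) ψ) x
    - spinConn G σ e (leviCivita G e (e i) (e i)) ψ x)

/-- `c(ω) = ∑ᵢ c(eⁱ) ⊗ ω(eᵢ)`. -/
def cOmega (σ : SpinorModule m S) (e : Fin (2 * m + 1) → VField (2 * m + 1) M)
    (g : M → Matrix.unitaryGroup (Fin N) ℂ) (ψ : M → Fin N → S) : M → Fin N → S :=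
  fun x => ∑ i, cliff σ i (matAct (omega g (e i) x) (ψ x))

/-- `c(ω²) = ∑ᵢⱼ c(eⁱ) c(eʲ) ⊗ ω(eᵢ) ω(eⱼ)`, for the square `ω²` of `ω` in the algebra
`C(T^*M) ⊗ Mat_N(ℂ)`. -/
def cOmegaSq (σ : SpinorModule m S) (e : Fin (2 * m + 1) → VField (2 * m + 1) M)
    (g : M → Matrix.unitaryGroup (Fin N) ℂ) (ψ : M → Fin N → S) : M → Fin N → S :=
  fun x => ∑ i, ∑ j, cliff σ i (cliff σ j (matAct (omega g (e i) x * omega g (e j) x) (ψ x)))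

/-- `c(dω) = ∑_{i<j} c(eⁱ) c(eʲ) ⊗ dω(eᵢ, eⱼ)`. -/
def cDOmega (σ : SpinorModule m S) (e : Fin (2 * m + 1) → VField (2 * m + 1) M)
    (g : M → Matrix.unitaryGroup (Fin N) ℂ) (ψ : M → Fin N → S) : M → Fin N → S :=
  fun x => ∑ i, ∑ j ∈ Finset.Ioi i,
    cliff σ i (cliff σ j (matAct (dOmega g (e i) (e j) x) (ψ x)))

/-- `ι(ω^*)∇^S = ∑ᵢ ω(eᵢ) ∇_{eᵢ}`, the contraction of `∇^S` with the matrix-valued vector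
field `ω^* = ∑ᵢ ω(eᵢ) eᵢ` dual to `ω`. -/
def contractOmega (G : RiemMetric (2 * m + 1) M) (σ : SpinorModule m S)
    (e : Fin (2 * m + 1) → VField (2 * m + 1) M)
    (g : M → Matrix.unitaryGroup (Fin N) ℂ) (ψ : M → Fin N → S) : M → Fin N → S :=
  fun x => ∑ i, matAct (omega g (e i) x) (spinConn G σ e (e i) ψ x)

end Operators

end

/-!
The proof is a computation in the given orthonormal frame `e`, over the open set where it is
defined. Write `∂ᵢ` for the derivative along `eᵢ`, `Γᵢⱼₖ = ⟨∇_{eᵢ} eⱼ, eₖ⟩` and `Cᵢⱼₖ = ⟨[eᵢ, eⱼ], eₖ⟩`.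

* The Levi-Civita connection is metric and torsion-free: `Γ` is skew in its last two indices and
  `Γᵢⱼₖ - Γⱼᵢₖ = Cᵢⱼₖ`. Hence Clifford multiplication is parallel (`spinConn_cliff`), and `D` applied
  to a contraction `∑ⱼ c(eʲ) φⱼ` is `∑ᵢⱼ c(eⁱ) c(eʲ) (∇φ)(eᵢ, eⱼ)` (`dirac_sum_cliff`). Any such
  double contraction splits into minus the trace and the skew-symmetric part, by the Clifford
  relations (`sum_gen_gen_apply`). This splitting computes both `D²` and the term linear in `u`.
* For `φⱼ = ∇_{eⱼ} ψ` the trace is `Δψ` and the skew-symmetric part is the curvature of the spinor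
  bundle, which is the Clifford action of the Riemann tensor (`spinConn_curvature`). The first
  Bianchi identity, i.e. the Jacobi identity for the frame (`riemannCoeff_bianchi`), collapses
  its contraction to a quarter of the scalar curvature (`sum_curvature_gen`). This is the
  Lichnerowicz formula `dirac_dirac`.
* For `φⱼ = ω(eⱼ) ψ` the trace of `∇ω` gives `d^*ω`, its skew-symmetric part gives `c(dω)`, and the
  terms in which `∇` falls on `ψ` combine with `c(ω) D` to `-2 ι(ω^*)∇`
  (`dirac_cOmega_add_cOmega_dirac`).
* Since `g⁻¹ D g = D + c(ω)` by the product rule, `D_u = D + u c(ω)` (`diracU_eq`). Squaring and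
  differentiating this affine function of `u` gives the two claims.
-/

open scoped Topology
open VectorField

/-! ### Contractions in a Clifford algebra -/

section CliffordIdentities

lemma sum_cyclic {n : ℕ} {V : Type*} [AddCommMonoid V] (f : Fin n → Fin n → Fin n → V) :
    ∑ i, ∑ j, ∑ k, f j k i = ∑ i, ∑ j, ∑ k, f i j k := by
  rw [Finset.sum_comm]
  refine Finset.sum_congr rfl fun j _ => ?_
  rw [Finset.sum_comm]

lemma sum_smul_ite {n : ℕ} {V : Type*} [AddCommMonoid V] [Module ℝ V] (r : Fin n → ℝ) (t : ℝ)
    (f : Fin n → V) (i : Fin n) :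
    ∑ k, (r k * if k = i then t else 0) • f k = (r i * t) • f i := by
  rw [Finset.sum_eq_single i (fun k _ hk => by simp [hk]) (by simp)]
  simp

variable {n : ℕ} {A : Type*} [Ring A] [Algebra ℝ A] {c : Fin n → A}

/-- The commutator of a quadratic Clifford element with a generator is the action of the
corresponding skew-symmetric matrix. -/
lemma quadratic_mul_gen
    (hc : ∀ i j, c i * c j + c j * c i = (if i = j then (-2 : ℝ) else 0) • (1 : A))
    (a : Fin n → Fin n → ℝ) (ha : ∀ j k, a j k = -a k j) (l : Fin n) :
    ((1 / 4 : ℝ) • ∑ j, ∑ k, a j k • (c j * c k)) * c l =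
      c l * ((1 / 4 : ℝ) • ∑ j, ∑ k, a j k • (c j * c k)) + ∑ k, a l k • c k := by
  have h : ∀ j k, c j * c k * c l = c l * (c j * c k) + (if k = l then (-2 : ℝ) else 0) • c j
      - (if j = l then (-2 : ℝ) else 0) • c k := by
    intro j k
    have h1 := congrArg (c j * ·) (hc k l)
    have h2 := congrArg (· * c k) (hc j l)
    simp only [mul_add, add_mul, mul_smul_comm, smul_mul_assoc, mul_one, one_mul] at h1 h2
    rw [← h1, ← h2]
    noncomm_ring
  have h1 : ∑ k, a l k • c k = (1 / 4 : ℝ) • ∑ j, ∑ k, (a j k *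
      (if k = l then (-2 : ℝ) else 0)) • c j - (1 / 4 : ℝ) • ∑ j, ∑ k, (a j k *
      (if j = l then (-2 : ℝ) else 0)) • c k := by
    rw [Finset.sum_comm (f := fun j k => (a j k * (if j = l then (-2 : ℝ) else 0)) • c k)]
    simp only [mul_ite, mul_zero, ite_smul, zero_smul, Finset.sum_ite_eq', Finset.mem_univ, if_true,
      Finset.smul_sum, ← Finset.sum_sub_distrib]
    refine Finset.sum_congr rfl fun k _ => ?_
    rw [ha k l]
    module
  rw [h1]
  simp only [smul_mul_assoc, mul_smul_comm, Finset.sum_mul, Finset.mul_sum, h, smul_add, smul_sub,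
    Finset.sum_add_distrib, Finset.sum_sub_distrib, smul_smul]
  abel

/-- Skew-symmetric matrices act on quadratic Clifford elements by commutators. -/
lemma quadratic_commutator
    (hc : ∀ i j, c i * c j + c j * c i = (if i = j then (-2 : ℝ) else 0) • (1 : A))
    (a b : Fin n → Fin n → ℝ) (ha : ∀ j k, a j k = -a k j) :
    ((1 / 4 : ℝ) • ∑ j, ∑ k, a j k • (c j * c k)) * ((1 / 4 : ℝ) • ∑ j, ∑ k, b j k • (c j * c k)) =
      ((1 / 4 : ℝ) • ∑ j, ∑ k, b j k • (c j * c k)) * ((1 / 4 : ℝ) • ∑ j, ∑ k, a j k • (c j * c k))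
      + (1 / 4 : ℝ) • ∑ k, ∑ l, (∑ s, (b k s * a s l - a k s * b s l)) • (c k * c l) := by
  set P := (1 / 4 : ℝ) • ∑ j, ∑ k, a j k • (c j * c k) with hP
  have h : ∀ k l, P * (c k * c l) = c k * c l * P + ((∑ s, a l s • (c k * c s))
      + ∑ s, a k s • (c s * c l)) := by
    intro k l
    rw [← mul_assoc, quadratic_mul_gen hc a ha k, ← hP, add_mul, mul_assoc,
      quadratic_mul_gen hc a ha l, ← hP]
    simp only [mul_add, Finset.sum_mul, Finset.mul_sum, smul_mul_assoc, mul_smul_comm]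
    noncomm_ring
  have h1 : ∑ k, ∑ l, (∑ s, (b k s * a s l - a k s * b s l)) • (c k * c l) =
      ∑ k, ∑ l, ((∑ s, (b k l * a l s) • (c k * c s)) + ∑ s, (b k l * a k s) • (c s * c l)) := by
    simp only [Finset.sum_smul, Finset.sum_add_distrib, sub_eq_add_neg, add_smul]
    congr 1
    · refine Finset.sum_congr rfl fun k _ => ?_
      rw [Finset.sum_comm]
    · rw [Finset.sum_comm]
      conv_rhs => rw [Finset.sum_comm]
      refine Finset.sum_congr rfl fun l _ => ?_
      rw [Finset.sum_comm]
      refine Finset.sum_congr rfl fun s _ => Finset.sum_congr rfl fun k _ => ?_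
      rw [ha]
      module
  rw [h1]
  simp only [mul_smul_comm, smul_mul_assoc, Finset.mul_sum, Finset.sum_mul, h, smul_add,
    Finset.sum_add_distrib, Finset.smul_sum, smul_smul, mul_assoc]

/-- The Clifford contraction of a three-index tensor which is skew in its first two indices and
satisfies the first Bianchi identity reduces to its trace: cyclic permutations of `cᵢ cⱼ cₖ` differ
only by terms linear in the generators, and the cubic terms cancel by the Bianchi identity. -/
lemma sum_bianchi_gen_gen_gen
    (hc : ∀ i j, c i * c j + c j * c i = (if i = j then (-2 : ℝ) else 0) • (1 : A))
    (R : Fin n → Fin n → Fin n → ℝ) (hR : ∀ i j k, R i j k = -R j i k)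
    (hB : ∀ i j k, R i j k + R j k i + R k i j = 0) :
    ∑ i, ∑ j, ∑ k, R i j k • (c i * c j * c k) = (-2 : ℝ) • ∑ k, (∑ i, R k i i) • c k := by
  have h2 : ∀ i j k, c j * c k * c i = c i * c j * c k + (if k = i then (-2 : ℝ) else 0) • c j
      - (if j = i then (-2 : ℝ) else 0) • c k := by
    intro i j k
    have h1 := congrArg (c j * ·) (hc k i)
    have h2 := congrArg (· * c k) (hc j i)
    simp only [mul_add, add_mul, mul_smul_comm, smul_mul_assoc, mul_one, one_mul] at h1 h2
    rw [← h1, ← h2]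
    noncomm_ring
  have h3 : ∀ i j k, c k * c i * c j = c i * c j * c k + (if k = i then (-2 : ℝ) else 0) • c j
      - (if k = j then (-2 : ℝ) else 0) • c i := by
    intro i j k
    have h1 := congrArg (c i * ·) (hc k j)
    have h2 := congrArg (· * c j) (hc k i)
    simp only [mul_add, add_mul, mul_smul_comm, smul_mul_assoc, mul_one, one_mul] at h1 h2
    rw [← h1, ← h2]
    noncomm_ring
  set T := ∑ i, ∑ j, ∑ k, R i j k • (c i * c j * c k) with hT
  have e2 : T = ∑ i, ∑ j, ∑ k, R j k i • (c j * c k * c i) :=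
    (sum_cyclic fun i j k => R i j k • (c i * c j * c k)).symm
  have e3 : T = ∑ i, ∑ j, ∑ k, R k i j • (c k * c i * c j) := by
    rw [e2]
    exact (sum_cyclic fun i j k => R j k i • (c j * c k * c i)).symm
  have e0 : T + (∑ i, ∑ j, ∑ k, R j k i • (c i * c j * c k))
      + (∑ i, ∑ j, ∑ k, R k i j • (c i * c j * c k)) = 0 := by
    rw [hT]
    simp only [← Finset.sum_add_distrib, ← add_smul, hB, zero_smul, Finset.sum_const_zero]
  have f2 : T = (∑ i, ∑ j, ∑ k, R j k i • (c i * c j * c k))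
      + (-4 : ℝ) • ∑ k, (∑ i, R k i i) • c k := by
    have t1 : ∑ i, ∑ j, ∑ k, (R j k i * if k = i then -2 else 0) • c j =
        (-2 : ℝ) • ∑ k, (∑ i, R k i i) • c k := by
      rw [Finset.sum_comm]
      simp only [sum_smul_ite, Finset.smul_sum, Finset.sum_smul, smul_smul, mul_comm]
    have t2 : ∑ i, ∑ j, ∑ k, (R j k i * if j = i then -2 else 0) • c k =
        (2 : ℝ) • ∑ k, (∑ i, R k i i) • c k := by
      simp only [Finset.sum_comm (s := Finset.univ) (f := fun j k => (R j k _ * ite _ _ _) • c k)]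
      simp only [fun i k => sum_smul_ite (fun j => R j k i) (-2) (fun _ => c k) i]
      rw [Finset.sum_comm]
      simp only [Finset.smul_sum, Finset.sum_smul, smul_smul]
      refine Finset.sum_congr rfl fun k _ => Finset.sum_congr rfl fun i _ => ?_
      rw [hR]
      module
    have t3 : T = ∑ i, ∑ j, ∑ k, (R j k i • (c i * c j * c k)
        + (R j k i * if k = i then -2 else 0) • c j
        - (R j k i * if j = i then -2 else 0) • c k) :=
      e2.trans (Finset.sum_congr rfl fun i _ => Finset.sum_congr rfl fun j _ =>
        Finset.sum_congr rfl fun k _ => by rw [h2 i j k]; module)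
    simp only [Finset.sum_add_distrib, Finset.sum_sub_distrib, t1, t2] at t3
    rw [t3]
    module
  have f3 : T = (∑ i, ∑ j, ∑ k, R k i j • (c i * c j * c k))
      + (-2 : ℝ) • ∑ k, (∑ i, R k i i) • c k := by
    have t1 : ∑ i, ∑ j, ∑ k, (R k i j * if k = i then -2 else 0) • c j = 0 := by
      have hR0 : ∀ i j, R i i j = 0 := fun i j => by linarith [hR i i j]
      simp only [sum_smul_ite, hR0, zero_mul, zero_smul, Finset.sum_const_zero]
    have t2 : ∑ i, ∑ j, ∑ k, (R k i j * if k = j then -2 else 0) • c i =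
        (2 : ℝ) • ∑ k, (∑ i, R k i i) • c k := by
      simp only [sum_smul_ite, Finset.smul_sum, Finset.sum_smul, smul_smul]
      refine Finset.sum_congr rfl fun k _ => Finset.sum_congr rfl fun i _ => ?_
      rw [hR]
      module
    have t3 : T = ∑ i, ∑ j, ∑ k, (R k i j • (c i * c j * c k)
        + (R k i j * if k = i then -2 else 0) • c j
        - (R k i j * if k = j then -2 else 0) • c i) :=
      e3.trans (Finset.sum_congr rfl fun i _ => Finset.sum_congr rfl fun j _ =>
        Finset.sum_congr rfl fun k _ => by rw [h3 i j k]; module)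
    simp only [Finset.sum_add_distrib, Finset.sum_sub_distrib, t1, t2] at t3
    rw [t3]
    module
  clear_value T
  have h6 : (3 : ℝ) • T = (-6 : ℝ) • ∑ k, (∑ i, R k i i) • c k := by
    have g2 := eq_sub_of_add_eq f2.symm
    have g3 := eq_sub_of_add_eq f3.symm
    rw [g2, g3] at e0
    rw [← add_zero ((-6 : ℝ) • _), ← e0]
    module
  calc T = (1 / 3 : ℝ) • (3 : ℝ) • T := by module
    _ = _ := by rw [h6]; module

lemma sum_symm_gen_gen
    (hc : ∀ i j, c i * c j + c j * c i = (if i = j then (-2 : ℝ) else 0) • (1 : A))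
    (r : Fin n → Fin n → ℝ) (hr : ∀ k l, r k l = r l k) :
    ∑ k, ∑ l, r k l • (c k * c l) = -(∑ k, r k k) • (1 : A) := by
  have h : ∑ k, ∑ l, r k l • (c k * c l) + ∑ k, ∑ l, r k l • (c k * c l) =
      ∑ k, ∑ l, (r k l * (if k = l then (-2 : ℝ) else 0)) • (1 : A) := by
    conv_lhs => enter [2]; rw [Finset.sum_comm]
    simp only [← Finset.sum_add_distrib]
    refine Finset.sum_congr rfl fun k _ => Finset.sum_congr rfl fun l _ => ?_
    rw [mul_smul, ← hc, hr l k, smul_add]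
  have h' : ∑ k, ∑ l, (r k l * (if k = l then (-2 : ℝ) else 0)) • (1 : A) =
      (-2 * ∑ k, r k k) • (1 : A) := by
    simp only [← Finset.sum_smul, mul_ite, mul_zero, Finset.sum_ite_eq, Finset.mem_univ, if_true,
      Finset.mul_sum, mul_comm]
  rw [h'] at h
  generalize ∑ k, ∑ l, r k l • (c k * c l) = T at h ⊢
  calc T = (1 / 2 : ℝ) • (T + T) := by module
    _ = _ := by rw [h]; module

/-- The Clifford contraction of an algebraic curvature tensor is a scalar. -/
lemma sum_curvature_gen
    (hc : ∀ i j, c i * c j + c j * c i = (if i = j then (-2 : ℝ) else 0) • (1 : A))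
    (R : Fin n → Fin n → Fin n → Fin n → ℝ) (hR : ∀ i j k l, R i j k l = -R j i k l)
    (hR' : ∀ i j k l, R i j k l = -R i j l k)
    (hB : ∀ i j k l, R i j k l + R j k i l + R k i j l = 0) :
    ∑ i, ∑ j, ∑ k, ∑ l, R i j k l • (c i * c j * (c k * c l)) =
      (2 * ∑ i, ∑ j, R i j j i) • (1 : A) := by
  -- The pair symmetry of the curvature tensor makes its Ricci contraction symmetric.
  have hpair : ∀ k i j l, R k i j l = R j l k i := fun k i j l => by
    linarith [hB i j k l, hB j k l i, hB k l i j, hB l i j k, hR' i j k l, hR' j k i l,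
      hR' k l i j, hR' l i j k, hR i k l j, hR' k i l j, hR j l i k, hR' l j i k, hR j l k i]
  have h1 : ∑ i, ∑ j, ∑ k, ∑ l, R i j k l • (c i * c j * (c k * c l)) =
      ∑ l, (∑ i, ∑ j, ∑ k, R i j k l • (c i * c j * c k)) * c l := by
    simp only [Finset.sum_mul]
    conv_rhs => rw [Finset.sum_comm]
    refine Finset.sum_congr rfl fun i _ => ?_
    conv_rhs => rw [Finset.sum_comm]
    refine Finset.sum_congr rfl fun j _ => ?_
    conv_rhs => rw [Finset.sum_comm]
    simp only [smul_mul_assoc, mul_assoc]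
  have h2 : ∑ l, (∑ i, ∑ j, ∑ k, R i j k l • (c i * c j * c k)) * c l =
      (-2 : ℝ) • ∑ k, ∑ l, (∑ i, R k i i l) • (c k * c l) := by
    rw [Finset.sum_comm, Finset.smul_sum]
    refine Finset.sum_congr rfl fun l _ => ?_
    rw [sum_bianchi_gen_gen_gen hc (fun i j k => R i j k l) (fun i j k => hR i j k l)
      fun i j k => hB i j k l]
    simp only [smul_mul_assoc, Finset.sum_mul]
  rw [h1, h2, sum_symm_gen_gen hc]
  · module
  · intro k l
    refine Finset.sum_congr rfl fun i _ => ?_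
    rw [hpair, hR, hR', neg_neg]

lemma sum_eq_two_smul_sum_Ioi {V : Type*} [AddCommGroup V] [Module ℝ V] (f : Fin n → Fin n → V)
    (hf : ∀ i j, f i j = f j i) (hf0 : ∀ i, f i i = 0) :
    ∑ i, ∑ j, f i j = (2 : ℝ) • ∑ i, ∑ j ∈ Finset.Ioi i, f i j := by
  have h : ∀ i, ∑ j ∈ Finset.Ioi i, f i j = ∑ j, if i < j then f i j else 0 := fun i => by
    rw [← Finset.sum_filter]
    congr 1
    ext; simp
  have h' : ∑ i, ∑ j, (if j < i then f i j else 0) = ∑ i, ∑ j, if i < j then f i j else 0 := by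
    rw [Finset.sum_comm]
    simp only [hf]
  simp only [h, two_smul]
  nth_rewrite 2 [← h']
  simp only [← Finset.sum_add_distrib]
  refine Finset.sum_congr rfl fun i _ => Finset.sum_congr rfl fun j _ => ?_
  rcases lt_trichotomy i j with hij | rfl | hij
  · simp [hij, hij.le]
  · simp [hf0]
  · simp [hij, hij.le]

variable {V : Type*} [AddCommGroup V] [Module ℝ V] {C : Fin n → Module.End ℝ V}

/-- Splitting a Clifford contraction into its trace and its skew-symmetric part. -/
lemma sum_gen_gen_apply
    (hC : ∀ i j, C i * C j + C j * C i = (if i = j then (-2 : ℝ) else 0) • (1 : Module.End ℝ V))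
    (H : Fin n → Fin n → V) :
    ∑ i, ∑ j, C i (C j (H i j)) =
      -∑ i, H i i + (1 / 2 : ℝ) • ∑ i, ∑ j, C i (C j (H i j - H j i)) := by
  have h : ∀ i j, C i (C j (H j i)) =
      -C j (C i (H j i)) + (if i = j then (-2 : ℝ) else 0) • H j i := fun i j => by
    have := LinearMap.congr_fun (hC i j) (H j i)
    simp only [LinearMap.add_apply, Module.End.mul_apply, LinearMap.smul_apply,
      Module.End.one_apply] at this
    rw [← this]
    abel
  have h1 : ∑ i, ∑ j, C i (C j (H j i)) =
      -(∑ i, ∑ j, C i (C j (H i j))) + (-2 : ℝ) • ∑ i, H i i := by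
    simp only [h, Finset.sum_add_distrib, ite_smul, zero_smul, Finset.sum_ite_eq, Finset.mem_univ,
      if_true, Finset.sum_neg_distrib, Finset.smul_sum]
    rw [Finset.sum_comm]
  simp only [map_sub, Finset.sum_sub_distrib, h1]
  module

/-- The form of `sum_gen_gen_apply` in which the skew-symmetric part is summed over `i < j`. -/
lemma sum_gen_gen_apply_Ioi
    (hC : ∀ i j, C i * C j + C j * C i = (if i = j then (-2 : ℝ) else 0) • (1 : Module.End ℝ V))
    (H : Fin n → Fin n → V) :
    ∑ i, ∑ j, C i (C j (H i j)) =
      -∑ i, H i i + ∑ i, ∑ j ∈ Finset.Ioi i, C i (C j (H i j - H j i)) := by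
  rw [sum_gen_gen_apply hC, sum_eq_two_smul_sum_Ioi (fun i j => C i (C j (H i j - H j i))),
    smul_smul]
  · norm_num
  · intro i j
    rcases eq_or_ne i j with rfl | hij
    · rfl
    have := LinearMap.congr_fun (hC i j) (H i j - H j i)
    simp only [LinearMap.add_apply, Module.End.mul_apply, hij, if_false, zero_smul,
      LinearMap.zero_apply] at this
    rw [eq_neg_of_add_eq_zero_left this, ← map_neg, ← map_neg, neg_sub]
  · simp

end CliffordIdentities

/-! ### Directional derivatives on a manifold and the Lie bracket -/

section DirectionalDerivative

variable {n : ℕ} {M : Type*} [TopologicalSpace M]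
  [ChartedSpace (EuclideanSpace ℝ (Fin n)) M]
  {F : Type*} [NormedAddCommGroup F] [NormedSpace ℝ F]
  {F' : Type*} [NormedAddCommGroup F'] [NormedSpace ℝ F']
  {f g : M → F} {x : M}

lemma mvfderiv_congr (h : f =ᶠ[𝓝 x] g) : mvfderiv (𝓡 n) f x = mvfderiv (𝓡 n) g x := by
  ext v
  simp only [mvfderiv, ContinuousLinearMap.comp_apply]
  exact congrArg (fun L : EuclideanSpace ℝ (Fin n) →L[ℝ] F => L v) h.mfderiv_eq

lemma mvfderiv_clm_comp (L : F →L[ℝ] F') (hf : MDifferentiableAt (𝓡 n) 𝓘(ℝ, F) f x) :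
    mvfderiv (𝓡 n) (fun y => L (f y)) x = L ∘L mvfderiv (𝓡 n) f x := by
  ext v
  simp only [mvfderiv, ContinuousLinearMap.comp_apply]
  have h : HasMFDerivAt 𝓘(ℝ, F) 𝓘(ℝ, F') L (f x) L := L.hasMFDerivAt
  have := (h.comp x hf.hasMFDerivAt).mfderiv
  exact congrArg (fun L : EuclideanSpace ℝ (Fin n) →L[ℝ] F' => L v) this

lemma mvfderiv_bilinear {F'' : Type*} [NormedAddCommGroup F''] [NormedSpace ℝ F'']
    (B : F →L[ℝ] F' →L[ℝ] F'') {h : M → F'}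
    (hf : MDifferentiableAt (𝓡 n) 𝓘(ℝ, F) f x) (hh : MDifferentiableAt (𝓡 n) 𝓘(ℝ, F') h x)
    (v : TangentSpace (𝓡 n) x) :
    mvfderiv (𝓡 n) (fun y => B (f y) (h y)) x v =
      B (mvfderiv (𝓡 n) f x v) (h x) + B (f x) (mvfderiv (𝓡 n) h x v) := by
  have h1 : HasMFDerivAt 𝓘(ℝ, F × F') 𝓘(ℝ, F'') (fun p : F × F' => B p.1 p.2) (f x, h x) _ :=
    (B.isBoundedBilinearMap.hasFDerivAt (f x, h x)).hasMFDerivAt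
  have h2 : HasMFDerivAt (𝓡 n) 𝓘(ℝ, F × F') (fun y => (f y, h y)) x
      ((mvfderiv (𝓡 n) f x).prod (mvfderiv (𝓡 n) h x)) :=
    ⟨hf.continuousAt.prodMk hh.continuousAt, hf.hasMFDerivAt.2.prodMk hh.hasMFDerivAt.2⟩
  have h3 := (h1.comp x h2).mfderiv
  refine (congrArg (fun L : EuclideanSpace ℝ (Fin n) →L[ℝ] F'' => L v) h3).trans ?_
  exact add_comm _ _

lemma mvfderiv_fun_sum {κ : Type*} (s : Finset κ) {f : κ → M → F}
    (hf : ∀ k ∈ s, MDifferentiableAt (𝓡 n) 𝓘(ℝ, F) (f k) x) :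
    mvfderiv (𝓡 n) (fun y => ∑ k ∈ s, f k y) x = ∑ k ∈ s, mvfderiv (𝓡 n) (f k) x := by
  classical
  have key : MDifferentiableAt (𝓡 n) 𝓘(ℝ, F) (fun y => ∑ k ∈ s, f k y) x ∧
      mvfderiv (𝓡 n) (fun y => ∑ k ∈ s, f k y) x = ∑ k ∈ s, mvfderiv (𝓡 n) (f k) x := by
    induction s using Finset.induction_on with
    | empty =>
      simp only [Finset.sum_empty]
      exact ⟨mdifferentiableAt_const, mvfderiv_const 0⟩
    | insert a s ha ih =>
      obtain ⟨h1, h2⟩ := ih fun k hk => hf k (Finset.mem_insert_of_mem hk)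
      have h0 := hf a (Finset.mem_insert_self _ _)
      simp only [Finset.sum_insert ha]
      exact ⟨h0.add h1, by rw [mvfderiv_fun_add h0 h1, h2]⟩
  exact key.2

variable [IsManifold (𝓡 n) ∞ M]

lemma ContMDiffOn.mvfderiv_apply {U : Set M} (hU : IsOpen U)
    (hf : ContMDiffOn (𝓡 n) 𝓘(ℝ, F) ∞ f U) {X : (x : M) → TangentSpace (𝓡 n) x}
    (hX : ContMDiffOn (𝓡 n) ((𝓡 n).prod 𝓘(ℝ, EuclideanSpace ℝ (Fin n))) ∞
      (fun x => (TotalSpace.mk' (EuclideanSpace ℝ (Fin n)) x (X x) :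
        TotalSpace (EuclideanSpace ℝ (Fin n)) (fun x : M => TangentSpace (𝓡 n) x))) U) :
    ContMDiffOn (𝓡 n) 𝓘(ℝ, F) ∞ (fun x => mvfderiv (𝓡 n) f x (X x)) U := by
  have : IsManifold (𝓡 n) 1 M := IsManifold.of_le (n := ∞) (by norm_cast)
  have h1 := hf.contMDiffOn_tangentMapWithin (m := ∞) (by rfl) hU.uniqueMDiffOn
  have h2 := h1.comp hX (fun x hx => hx)
  have h3 := (contMDiff_snd_tangentBundle_modelSpace F 𝓘(ℝ, F) (n := ∞)).comp_contMDiffOn h2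
  refine h3.congr fun x hx => ?_
  simp only [Function.comp, tangentMapWithin, mfderivWithin_of_isOpen hU hx]
  rfl

/-- A smooth vector field on an open set, as a section of the tangent bundle. -/
abbrev SmoothFieldOn (X : (x : M) → TangentSpace (𝓡 n) x) (U : Set M) : Prop :=
  ContMDiffOn (𝓡 n) ((𝓡 n).prod 𝓘(ℝ, EuclideanSpace ℝ (Fin n))) ∞
    (fun x => (TotalSpace.mk' (EuclideanSpace ℝ (Fin n)) x (X x) :
      TotalSpace (EuclideanSpace ℝ (Fin n)) (fun x : M => TangentSpace (𝓡 n) x))) U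

lemma SmoothFieldOn.mlieBracket {U : Set M} (hU : IsOpen U)
    {X Y : (x : M) → TangentSpace (𝓡 n) x} (hX : SmoothFieldOn X U) (hY : SmoothFieldOn Y U) :
    SmoothFieldOn (mlieBracket (𝓡 n) X Y) U := by
  intro x hx
  have : IsManifold (𝓡 n) (minSmoothness ℝ 2) M :=
    IsManifold.of_le (n := ∞) (by simp; norm_cast)
  have : IsManifold (𝓡 n) (((⊤ : ℕ∞) : ℕ∞ω) + 1) M := ‹IsManifold (𝓡 n) ∞ M›
  exact (ContMDiffAt.mlieBracket_vectorField (m := ⊤) (n := ⊤)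
    ((hX x hx).contMDiffAt (hU.mem_nhds hx)) ((hY x hx).contMDiffAt (hU.mem_nhds hx))
    (by simp)).contMDiffWithinAt

lemma SmoothFieldOn.smul {U : Set M}
    {X : (x : M) → TangentSpace (𝓡 n) x} (hX : SmoothFieldOn X U) {f : M → ℝ}
    (hf : ContMDiffOn (𝓡 n) 𝓘(ℝ, ℝ) ∞ f U) :
    SmoothFieldOn (f • X) U :=
  ContMDiffOn.smul_section hf hX

/-- Differentiation along `[X, Y]` is the commutator of the differentiations along `X` and `Y`.
This follows from the Jacobi identity for `X`, `Y` and `f • Z`, where the Leibniz rule makes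
`X (Y f) - Y (X f) - [X, Y] f` the coefficient of the auxiliary vector field `Z`, which is
required not to vanish at `x`. -/
lemma mvfderiv_mlieBracket_real {U : Set M} (hU : IsOpen U)
    {X Y Z : (x : M) → TangentSpace (𝓡 n) x} (hX : SmoothFieldOn X U) (hY : SmoothFieldOn Y U)
    (hZ : SmoothFieldOn Z U) {f : M → ℝ}
    (hf : ContMDiffOn (𝓡 n) 𝓘(ℝ, ℝ) ∞ f U) (hx : x ∈ U) (hZx : Z x ≠ 0) :
    mvfderiv (𝓡 n) f x (mlieBracket (𝓡 n) X Y x) =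
      mvfderiv (𝓡 n) (fun y => mvfderiv (𝓡 n) f y (Y y)) x (X x) -
        mvfderiv (𝓡 n) (fun y => mvfderiv (𝓡 n) f y (X y)) x (Y x) := by
  have hn : U ∈ 𝓝 x := hU.mem_nhds hx
  have dX : ∀ {W : (x : M) → TangentSpace (𝓡 n) x}, SmoothFieldOn W U → ∀ y ∈ U,
      MDifferentiableAt (𝓡 n) ((𝓡 n).prod 𝓘(ℝ, EuclideanSpace ℝ (Fin n)))
      (fun x => (TotalSpace.mk' (EuclideanSpace ℝ (Fin n)) x (W x) :
      TotalSpace (EuclideanSpace ℝ (Fin n)) (fun x : M => TangentSpace (𝓡 n) x))) y :=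
    fun hW y hy => ((hW y hy).contMDiffAt (hU.mem_nhds hy)).mdifferentiableAt (by simp)
  have df : ∀ {h : M → ℝ}, ContMDiffOn (𝓡 n) 𝓘(ℝ, ℝ) ∞ h U → ∀ y ∈ U,
      MDifferentiableAt (𝓡 n) 𝓘(ℝ, ℝ) h y :=
    fun hW y hy => ((hW y hy).contMDiffAt (hU.mem_nhds hy)).mdifferentiableAt (by simp)
  have : IsManifold (𝓡 n) (minSmoothness ℝ 3) M :=
    IsManifold.of_le (n := ∞) (by simp; norm_cast)
  have : IsManifold (𝓡 n) 2 M := IsManifold.of_le (n := ∞) (by norm_cast)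
  have hJ := leibniz_identity_mlieBracket_apply (𝕜 := ℝ) (I := 𝓡 n) (U := X) (V := Y) (W := f • Z)
    (x := x) (((hX x hx).contMDiffAt hn).of_le (by simp; norm_cast))
    (((hY x hx).contMDiffAt hn).of_le (by simp; norm_cast))
    ((((hZ.smul hf) x hx).contMDiffAt hn).of_le (by simp; norm_cast))
  have hJ' := leibniz_identity_mlieBracket_apply (𝕜 := ℝ) (I := 𝓡 n) (U := X) (V := Y) (W := Z)
    (x := x) (((hX x hx).contMDiffAt hn).of_le (by simp; norm_cast))
    (((hY x hx).contMDiffAt hn).of_le (by simp; norm_cast))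
    (((hZ x hx).contMDiffAt hn).of_le (by simp; norm_cast))
  have e : ∀ {W : (x : M) → TangentSpace (𝓡 n) x}, SmoothFieldOn W U →
      mlieBracket (𝓡 n) W (f • Z) =ᶠ[𝓝 x]
      (fun y => mvfderiv (𝓡 n) f y (W y)) • Z + f • mlieBracket (𝓡 n) W Z := fun {W} hW => by
    filter_upwards [hn] with y hy
    exact mlieBracket_smul_right (df hf y hy) (dX hZ y hy)
  have e2 : ∀ {W W' : (x : M) → TangentSpace (𝓡 n) x}, SmoothFieldOn W U → SmoothFieldOn W' U →
      mlieBracket (𝓡 n) W' (mlieBracket (𝓡 n) W (f • Z)) x =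
      mvfderiv (𝓡 n) (fun y => mvfderiv (𝓡 n) f y (W y)) x (W' x) • Z x
      + mvfderiv (𝓡 n) f x (W x) • mlieBracket (𝓡 n) W' Z x
      + (mvfderiv (𝓡 n) f x (W' x) • mlieBracket (𝓡 n) W Z x
      + f x • mlieBracket (𝓡 n) W' (mlieBracket (𝓡 n) W Z) x) := fun {W W'} hW hW' => by
    rw [Filter.EventuallyEq.mlieBracket_vectorField_eq (Filter.EventuallyEq.refl _ W') (e hW)]
    have hd := hf.mvfderiv_apply hU hW
    rw [mlieBracket_add_right (dX (hZ.smul hd) x hx)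
      (dX ((SmoothFieldOn.mlieBracket hU hW hZ).smul hf) x hx),
      mlieBracket_smul_right (df hd x hx) (dX hZ x hx),
      mlieBracket_smul_right (df hf x hx) (dX (SmoothFieldOn.mlieBracket hU hW hZ) x hx)]
  rw [e2 hY hX, e2 hX hY, mlieBracket_smul_right (df hf x hx) (dX hZ x hx), hJ'] at hJ
  have : (mvfderiv (𝓡 n) f x (mlieBracket (𝓡 n) X Y x) -
      (mvfderiv (𝓡 n) (fun y => mvfderiv (𝓡 n) f y (Y y)) x (X x) -
        mvfderiv (𝓡 n) (fun y => mvfderiv (𝓡 n) f y (X y)) x (Y x))) • Z x = 0 := by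
    refine Eq.trans ?_ (sub_eq_zero.2 hJ.symm)
    module
  exact sub_eq_zero.1 ((smul_eq_zero.1 this).resolve_right hZx)

/-- The vector-valued version of `mvfderiv_mlieBracket_real`. -/
lemma mvfderiv_mlieBracket {U : Set M} (hU : IsOpen U)
    {X Y Z : (x : M) → TangentSpace (𝓡 n) x} (hX : SmoothFieldOn X U) (hY : SmoothFieldOn Y U)
    (hZ : SmoothFieldOn Z U)
    (hf : ContMDiffOn (𝓡 n) 𝓘(ℝ, F) ∞ f U) (hx : x ∈ U) (hZx : Z x ≠ 0) :
    mvfderiv (𝓡 n) f x (mlieBracket (𝓡 n) X Y x) =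
      mvfderiv (𝓡 n) (fun y => mvfderiv (𝓡 n) f y (Y y)) x (X x) -
        mvfderiv (𝓡 n) (fun y => mvfderiv (𝓡 n) f y (X y)) x (Y x) := by
  have df : ∀ {h : M → F}, ContMDiffOn (𝓡 n) 𝓘(ℝ, F) ∞ h U → ∀ y ∈ U,
      MDifferentiableAt (𝓡 n) 𝓘(ℝ, F) h y :=
    fun hW y hy => ((hW y hy).contMDiffAt (hU.mem_nhds hy)).mdifferentiableAt (by simp)
  refine (SeparatingDual.eq_iff_forall_dual_eq (R := ℝ)).2 fun L => ?_
  have hLf : ContMDiffOn (𝓡 n) 𝓘(ℝ, ℝ) ∞ (fun y => L (f y)) U :=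
    L.contMDiff.comp_contMDiffOn hf
  have h := mvfderiv_mlieBracket_real hU hX hY hZ hLf hx hZx
  have e : ∀ {W : (x : M) → TangentSpace (𝓡 n) x}, SmoothFieldOn W U →
      mvfderiv (𝓡 n) (fun y => mvfderiv (𝓡 n) (fun y => L (f y)) y (W y)) x =
      L ∘L mvfderiv (𝓡 n) (fun y => mvfderiv (𝓡 n) f y (W y)) x := fun {W} hW => by
    rw [← mvfderiv_clm_comp L (df (hf.mvfderiv_apply hU hW) x hx)]
    refine mvfderiv_congr ?_
    filter_upwards [hU.mem_nhds hx] with y hy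
    rw [mvfderiv_clm_comp L (df hf y hy)]
    rfl
  rw [e hX, e hY, mvfderiv_clm_comp L (df hf x hx)] at h
  simpa using h

end DirectionalDerivative

/-! ### Orthonormal frames, the Levi-Civita connection and its curvature -/

section Frame

variable {n : ℕ} {M : Type*} [TopologicalSpace M]
  [ChartedSpace (EuclideanSpace ℝ (Fin n)) M] [IsManifold (𝓡 n) ∞ M]

lemma contMDiffOn_inner (G : RiemMetric n M) {U : Set M} {X Y : VField n M}
    (hX : SmoothFieldOn X U) (hY : SmoothFieldOn Y U) :
    ContMDiffOn (𝓡 n) 𝓘(ℝ, ℝ) ∞ (fun x => G.inner x (X x) (Y x)) U := by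
  intro x hx
  have : ContMDiffWithinAt (𝓡 n) ((𝓡 n).prod 𝓘(ℝ)) ∞
      (fun m ↦ TotalSpace.mk' ℝ (E := Bundle.Trivial M ℝ) m (G.inner m (X m) (Y m))) U x := by
    apply ContMDiffWithinAt.clm_bundle_apply₂ (F₁ := EuclideanSpace ℝ (Fin n))
      (F₂ := EuclideanSpace ℝ (Fin n))
    · exact G.contMDiff.contMDiffAt.contMDiffWithinAt
    · exact hX x hx
    · exact hY x hx
  simp only [contMDiffWithinAt_totalSpace] at this
  exact this.2

/-- A smooth orthonormal frame `e` of the tangent bundle over an open set `U`. -/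
structure IsOrthonormalFrameOn (G : RiemMetric n M) (e : Fin n → VField n M) (U : Set M) :
    Prop where
  isOpen : IsOpen U
  smooth : ∀ i, SmoothFieldOn (e i) U
  orthonormal : ∀ x ∈ U, ∀ i j, G.inner x (e i x) (e j x) = if i = j then 1 else 0

/-- The structure functions `⟨[eᵢ, eⱼ], eₖ⟩` of a frame. -/
noncomputable def structureCoeff (G : RiemMetric n M) (e : Fin n → VField n M) (i j k : Fin n) (x : M) : ℝ :=
  G.inner x (mlieBracket (𝓡 n) (e i) (e j) x) (e k x)

lemma structureCoeff_swap (G : RiemMetric n M) (e : Fin n → VField n M) (i j k : Fin n) (x : M) :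
    structureCoeff G e i j k x = -structureCoeff G e j i k x := by
  simp only [structureCoeff]
  rw [mlieBracket_swap_apply, map_neg, neg_apply]

lemma leviCivitaCoeff_eq (G : RiemMetric n M) (e : Fin n → VField n M) (i j k : Fin n) (x : M) :
    leviCivitaCoeff G e i j k x = (1 / 2 : ℝ) * (structureCoeff G e i j k x -
      structureCoeff G e j k i x + structureCoeff G e k i j x) := rfl

/-- The Levi-Civita connection is metric. -/
lemma leviCivitaCoeff_swap (G : RiemMetric n M) (e : Fin n → VField n M) (i j k : Fin n) (x : M) :
    leviCivitaCoeff G e i j k x = -leviCivitaCoeff G e i k j x := by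
  simp only [leviCivitaCoeff_eq]
  linarith [structureCoeff_swap G e i j k x, structureCoeff_swap G e j k i x,
    structureCoeff_swap G e k i j x]

/-- The Levi-Civita connection is torsion-free. -/
lemma leviCivitaCoeff_sub (G : RiemMetric n M) (e : Fin n → VField n M) (i j k : Fin n) (x : M) :
    leviCivitaCoeff G e i j k x - leviCivitaCoeff G e j i k x = structureCoeff G e i j k x := by
  simp only [leviCivitaCoeff_eq]
  linarith [structureCoeff_swap G e i j k x, structureCoeff_swap G e j k i x,
    structureCoeff_swap G e k i j x]

namespace IsOrthonormalFrameOn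

variable {G : RiemMetric n M} {e : Fin n → VField n M} {U : Set M} {x : M}
  {F : Type*} [NormedAddCommGroup F] [NormedSpace ℝ F] {f : M → F}

lemma mdifferentiableAt (he : IsOrthonormalFrameOn G e U)
    (hf : ContMDiffOn (𝓡 n) 𝓘(ℝ, F) ∞ f U) (hx : x ∈ U) :
    MDifferentiableAt (𝓡 n) 𝓘(ℝ, F) f x :=
  ((hf x hx).contMDiffAt (he.isOpen.mem_nhds hx)).mdifferentiableAt (by simp)

lemma mdifferentiableAt_field (he : IsOrthonormalFrameOn G e U) {X : VField n M}
    (hX : SmoothFieldOn X U) (hx : x ∈ U) :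
    MDifferentiableAt (𝓡 n) ((𝓡 n).prod 𝓘(ℝ, EuclideanSpace ℝ (Fin n)))
      (fun x => (TotalSpace.mk' (EuclideanSpace ℝ (Fin n)) x (X x) :
      TotalSpace (EuclideanSpace ℝ (Fin n)) (fun x : M => TangentSpace (𝓡 n) x))) x :=
  ((hX x hx).contMDiffAt (he.isOpen.mem_nhds hx)).mdifferentiableAt (by simp)

lemma inner_sum_left (he : IsOrthonormalFrameOn G e U) (hx : x ∈ U) (r : Fin n → ℝ) (k : Fin n) :
    G.inner x (∑ i, r i • e i x) (e k x) = r k := by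
  simp only [map_sum, map_smul, sum_apply, smul_apply,
    he.orthonormal x hx, smul_eq_mul, mul_ite, mul_one, mul_zero, Finset.sum_ite_eq',
    Finset.mem_univ, if_true]

lemma sum_inner_smul (he : IsOrthonormalFrameOn G e U) (hx : x ∈ U) (v : TangentSpace (𝓡 n) x) :
    v = ∑ i, G.inner x v (e i x) • e i x := by
  have hli : LinearIndependent ℝ fun i => e i x := by
    rw [Fintype.linearIndependent_iff]
    intro r hr k
    rw [← he.inner_sum_left hx r k, hr, map_zero, zero_apply]
  have hcard : Fintype.card (Fin n) = Module.finrank ℝ (TangentSpace (𝓡 n) x) :=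
    (Fintype.card_fin n).trans (finrank_euclideanSpace_fin (𝕜 := ℝ)).symm
  have : FiniteDimensional ℝ (TangentSpace (𝓡 n) x) :=
    inferInstanceAs (FiniteDimensional ℝ (EuclideanSpace ℝ (Fin n)))
  have hspan := hli.span_eq_top_of_card_eq_finrank' hcard
  obtain ⟨r, rfl⟩ := (Submodule.mem_span_range_iff_exists_fun ℝ).1
    (hspan ▸ Submodule.mem_top : v ∈ _)
  simp only [he.inner_sum_left hx]

lemma ne_zero (he : IsOrthonormalFrameOn G e U) (hx : x ∈ U) (i : Fin n) : e i x ≠ 0 := by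
  intro h
  have := he.orthonormal x hx i i
  simp [h] at this

lemma smooth_structureCoeff (he : IsOrthonormalFrameOn G e U) (i j k : Fin n) :
    ContMDiffOn (𝓡 n) 𝓘(ℝ, ℝ) ∞ (structureCoeff G e i j k) U :=
  contMDiffOn_inner G (SmoothFieldOn.mlieBracket he.isOpen (he.smooth i) (he.smooth j)) (he.smooth k)

lemma smooth_leviCivitaCoeff (he : IsOrthonormalFrameOn G e U) (i j k : Fin n) :
    ContMDiffOn (𝓡 n) 𝓘(ℝ, ℝ) ∞ (leviCivitaCoeff G e i j k) U :=
  contMDiffOn_const.mul (((he.smooth_structureCoeff i j k).sub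
    (he.smooth_structureCoeff j k i)).add (he.smooth_structureCoeff k i j))

lemma mlieBracket_eq (he : IsOrthonormalFrameOn G e U) (hx : x ∈ U) (i j : Fin n) :
    mlieBracket (𝓡 n) (e i) (e j) x = ∑ k, structureCoeff G e i j k x • e k x :=
  he.sum_inner_smul hx _

/-- Derivatives along the frame commute up to the structure functions. -/
lemma mvfderiv_commutator (he : IsOrthonormalFrameOn G e U)
    (hf : ContMDiffOn (𝓡 n) 𝓘(ℝ, F) ∞ f U) (hx : x ∈ U) (i j : Fin n) :
    mvfderiv (𝓡 n) (fun y => mvfderiv (𝓡 n) f y (e j y)) x (e i x) -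
      mvfderiv (𝓡 n) (fun y => mvfderiv (𝓡 n) f y (e i y)) x (e j x) =
      ∑ k, structureCoeff G e i j k x • mvfderiv (𝓡 n) f x (e k x) := by
  rw [← mvfderiv_mlieBracket he.isOpen (he.smooth i) (he.smooth j) (he.smooth i) hf hx
    (he.ne_zero hx i), he.mlieBracket_eq hx]
  simp only [map_sum, map_smul]

lemma mlieBracket_sum_right (he : IsOrthonormalFrameOn G e U) (hx : x ∈ U) (i : Fin n)
    {r : Fin n → M → ℝ} (hr : ∀ k, ContMDiffOn (𝓡 n) 𝓘(ℝ, ℝ) ∞ (r k) U) :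
    mlieBracket (𝓡 n) (e i) (∑ k, r k • e k) x =
      ∑ k, (mvfderiv (𝓡 n) (r k) x (e i x) • e k x
        + r k x • mlieBracket (𝓡 n) (e i) (e k) x) := by
  classical
  have : IsManifold (𝓡 n) 2 M := IsManifold.of_le (n := ∞) (by norm_cast)
  have key : ∀ s : Finset (Fin n), SmoothFieldOn (∑ k ∈ s, r k • e k) U ∧
      mlieBracket (𝓡 n) (e i) (∑ k ∈ s, r k • e k) x =
      ∑ k ∈ s, (mvfderiv (𝓡 n) (r k) x (e i x) • e k x
        + r k x • mlieBracket (𝓡 n) (e i) (e k) x) := by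
    intro s
    induction s using Finset.induction_on with
    | empty =>
      simp only [Finset.sum_empty, mlieBracket_zero_right]
      exact ⟨(contMDiff_zeroSection ℝ _).contMDiffOn, rfl⟩
    | insert a s ha ih =>
      have h1 := (he.smooth a).smul (hr a)
      simp only [Finset.sum_insert ha]
      refine ⟨ContMDiffOn.add_section h1 ih.1, ?_⟩
      rw [mlieBracket_add_right (he.mdifferentiableAt_field h1 hx)
        (he.mdifferentiableAt_field ih.1 hx), ih.2,
        mlieBracket_smul_right (he.mdifferentiableAt (hr a) hx)
        (he.mdifferentiableAt_field (he.smooth a) hx)]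
  exact (key Finset.univ).2

/-- The components of `[eᵢ, [eⱼ, eₖ]]` in the frame. -/
lemma inner_mlieBracket_mlieBracket (he : IsOrthonormalFrameOn G e U) (hx : x ∈ U)
    (i j k l : Fin n) :
    G.inner x (mlieBracket (𝓡 n) (e i) (mlieBracket (𝓡 n) (e j) (e k)) x) (e l x) =
      mvfderiv (𝓡 n) (structureCoeff G e j k l) x (e i x) +
        ∑ a, structureCoeff G e j k a x * structureCoeff G e i a l x := by
  -- Naming the sum fixes its type as a section of the tangent bundle in the next statement.
  obtain ⟨W, hW⟩ : ∃ W : VField n M, W = ∑ a, structureCoeff G e j k a • e a := ⟨_, rfl⟩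
  have h : mlieBracket (𝓡 n) (e j) (e k) =ᶠ[𝓝 x] W := by
    filter_upwards [he.isOpen.mem_nhds hx] with y hy
    rw [hW]
    refine (he.mlieBracket_eq hy j k).trans ?_
    exact (Finset.sum_apply (M := fun y : M => TangentSpace (𝓡 n) y) y Finset.univ
      fun a => structureCoeff G e j k a • e a).symm
  rw [Filter.EventuallyEq.mlieBracket_vectorField_eq (Filter.EventuallyEq.refl _ (e i)) h, hW,
    he.mlieBracket_sum_right hx i fun a => he.smooth_structureCoeff j k a,
    Finset.sum_add_distrib, map_add, add_apply, he.inner_sum_left hx]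
  simp only [map_sum, map_smul, sum_apply, smul_apply,
    smul_eq_mul]
  rfl

/-- The Jacobi identity for the frame, in terms of the structure functions. -/
lemma structureCoeff_jacobi (he : IsOrthonormalFrameOn G e U) (hx : x ∈ U)
    (i j k l : Fin n) :
    (mvfderiv (𝓡 n) (structureCoeff G e j k l) x (e i x) +
        ∑ a, structureCoeff G e j k a x * structureCoeff G e i a l x) +
    (mvfderiv (𝓡 n) (structureCoeff G e k i l) x (e j x) +
        ∑ a, structureCoeff G e k i a x * structureCoeff G e j a l x) +
    (mvfderiv (𝓡 n) (structureCoeff G e i j l) x (e k x) +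
        ∑ a, structureCoeff G e i j a x * structureCoeff G e k a l x) = 0 := by
  have hn := he.isOpen.mem_nhds hx
  have : IsManifold (𝓡 n) (minSmoothness ℝ 3) M :=
    IsManifold.of_le (n := ∞) (by simp; norm_cast)
  have hs : ∀ i, ContMDiffAt (𝓡 n) ((𝓡 n).prod 𝓘(ℝ, EuclideanSpace ℝ (Fin n)))
      (minSmoothness ℝ 2) (fun x => (TotalSpace.mk' (EuclideanSpace ℝ (Fin n)) x (e i x) :
      TotalSpace (EuclideanSpace ℝ (Fin n)) (fun x : M => TangentSpace (𝓡 n) x))) x := fun i =>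
    ((he.smooth i x hx).contMDiffAt hn).of_le (by simp; norm_cast)
  have hJ := congrArg (fun v => G.inner x v (e l x))
    (leibniz_identity_mlieBracket_apply (hs i) (hs j) (hs k))
  have hk : (structureCoeff G e i k l) = fun x => -structureCoeff G e k i l x :=
    funext fun x => structureCoeff_swap G e i k l x
  simp only [map_add, add_apply] at hJ
  rw [mlieBracket_swap_apply (V := mlieBracket (𝓡 n) (e i) (e j)), map_neg,
    neg_apply, he.inner_mlieBracket_mlieBracket hx,
    he.inner_mlieBracket_mlieBracket hx, he.inner_mlieBracket_mlieBracket hx, hk,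
    mvfderiv_fun_neg] at hJ
  simp only [structureCoeff_swap G e i k, neg_mul, Finset.sum_neg_distrib,
    neg_apply] at hJ
  linarith

/-- The components of `∇_X Y` in the frame. -/
lemma inner_leviCivita (he : IsOrthonormalFrameOn G e U) (hx : x ∈ U) (X Y : VField n M)
    (k : Fin n) :
    G.inner x (leviCivita G e X Y x) (e k x) =
      mvfderiv (𝓡 n) (fun y => G.inner y (Y y) (e k y)) x (X x)
      + ∑ i, ∑ j, G.inner x (X x) (e i x) * G.inner x (Y x) (e j x)
        * leviCivitaCoeff G e i j k x :=
  he.inner_sum_left hx _ k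

/-- The components of `∇_X eⱼ` in the frame. -/
lemma inner_leviCivita_frame (he : IsOrthonormalFrameOn G e U) (hx : x ∈ U) (X : VField n M)
    (j k : Fin n) :
    G.inner x (leviCivita G e X (e j) x) (e k x) =
      ∑ i, G.inner x (X x) (e i x) * leviCivitaCoeff G e i j k x := by
  have h : (fun y => G.inner y (e j y) (e k y)) =ᶠ[𝓝 x] fun _ => if j = k then 1 else 0 := by
    filter_upwards [he.isOpen.mem_nhds hx] with y hy
    exact he.orthonormal y hy j k
  rw [he.inner_leviCivita hx, mvfderiv_congr h, mvfderiv_const, zero_apply, zero_add]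
  simp only [he.orthonormal x hx, mul_ite, mul_one, mul_zero, ite_mul, zero_mul,
    Finset.sum_ite_eq, Finset.mem_univ, if_true]

lemma inner_leviCivita_frame_frame (he : IsOrthonormalFrameOn G e U) (hx : x ∈ U) (i j k : Fin n) :
    G.inner x (leviCivita G e (e i) (e j) x) (e k x) = leviCivitaCoeff G e i j k x := by
  rw [he.inner_leviCivita_frame hx]
  simp only [he.orthonormal x hx, ite_mul, one_mul, zero_mul,
    Finset.sum_ite_eq, Finset.mem_univ, if_true]

/-- The components of `∇_{eᵢ} ∇_{eⱼ} eₖ` in the frame. -/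
lemma inner_leviCivita_leviCivita (he : IsOrthonormalFrameOn G e U) (hx : x ∈ U)
    (i j k l : Fin n) :
    G.inner x (leviCivita G e (e i) (leviCivita G e (e j) (e k)) x) (e l x) =
      mvfderiv (𝓡 n) (leviCivitaCoeff G e j k l) x (e i x) +
        ∑ a, leviCivitaCoeff G e j k a x * leviCivitaCoeff G e i a l x := by
  have h : (fun y => G.inner y (leviCivita G e (e j) (e k) y) (e l y)) =ᶠ[𝓝 x]
      leviCivitaCoeff G e j k l := by
    filter_upwards [he.isOpen.mem_nhds hx] with y hy
    exact he.inner_leviCivita_frame_frame hy j k l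
  rw [he.inner_leviCivita hx, mvfderiv_congr h]
  simp only [he.inner_leviCivita_frame_frame hx, he.orthonormal x hx, ite_mul, one_mul, zero_mul]
  rw [Finset.sum_comm]
  simp only [Finset.sum_ite_eq, Finset.mem_univ, if_true]

end IsOrthonormalFrameOn

/-- The components `⟨R(eᵢ, eⱼ) eₖ, eₗ⟩` of the Riemann curvature in a frame, in terms of the
connection coefficients. -/
noncomputable def riemannCoeff (G : RiemMetric n M) (e : Fin n → VField n M) (i j k l : Fin n)
    (x : M) : ℝ :=
  mvfderiv (𝓡 n) (leviCivitaCoeff G e j k l) x (e i x)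
    - mvfderiv (𝓡 n) (leviCivitaCoeff G e i k l) x (e j x)
    + ∑ a, (leviCivitaCoeff G e j k a x * leviCivitaCoeff G e i a l x
      - leviCivitaCoeff G e i k a x * leviCivitaCoeff G e j a l x)
    - ∑ a, structureCoeff G e i j a x * leviCivitaCoeff G e a k l x

lemma riemannCoeff_swap (G : RiemMetric n M) (e : Fin n → VField n M) (i j k l : Fin n) (x : M) :
    riemannCoeff G e i j k l x = -riemannCoeff G e j i k l x := by
  simp only [riemannCoeff, structureCoeff_swap G e i j, neg_mul, Finset.sum_neg_distrib,
    Finset.sum_sub_distrib]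
  ring

lemma riemannCoeff_swap' (G : RiemMetric n M) (e : Fin n → VField n M) (i j k l : Fin n) (x : M) :
    riemannCoeff G e i j k l x = -riemannCoeff G e i j l k x := by
  have h : ∀ j, leviCivitaCoeff G e j k l = fun x => -leviCivitaCoeff G e j l k x := fun j =>
    funext fun x => leviCivitaCoeff_swap G e j k l x
  have h2 : ∀ i j, ∑ a, leviCivitaCoeff G e j k a x * leviCivitaCoeff G e i a l x =
      ∑ a, leviCivitaCoeff G e i l a x * leviCivitaCoeff G e j a k x := fun i j =>
    Finset.sum_congr rfl fun a _ => by
      rw [leviCivitaCoeff_swap G e j k a, leviCivitaCoeff_swap G e i a l]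
      ring
  simp only [riemannCoeff, h, mvfderiv_fun_neg, neg_apply, mul_neg, Finset.sum_neg_distrib,
    Finset.sum_sub_distrib, h2]
  ring

/-- The first Bianchi identity. -/
lemma riemannCoeff_bianchi {G : RiemMetric n M} {e : Fin n → VField n M} {U : Set M}
    (he : IsOrthonormalFrameOn G e U) {x : M} (hx : x ∈ U) (i j k l : Fin n) :
    riemannCoeff G e i j k l x + riemannCoeff G e j k i l x + riemannCoeff G e k i j l x = 0 := by
  have hd : ∀ i j k, mvfderiv (𝓡 n) (structureCoeff G e j k l) x (e i x) =
      mvfderiv (𝓡 n) (leviCivitaCoeff G e j k l) x (e i x)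
      - mvfderiv (𝓡 n) (leviCivitaCoeff G e k j l) x (e i x) := fun i j k => by
    rw [← sub_apply, ← mvfderiv_fun_sub
      (he.mdifferentiableAt (he.smooth_leviCivitaCoeff j k l) hx)
      (he.mdifferentiableAt (he.smooth_leviCivitaCoeff k j l) hx)]
    congr 2
    exact funext fun x => (leviCivitaCoeff_sub G e j k l x).symm
  have hJ := he.structureCoeff_jacobi hx i j k l
  rw [hd, hd, hd] at hJ
  simp only [← leviCivitaCoeff_sub, mul_sub, sub_mul, Finset.sum_sub_distrib] at hJ
  simp only [riemannCoeff, ← leviCivitaCoeff_sub, sub_mul, Finset.sum_sub_distrib]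
  linarith

/-- The scalar curvature in terms of the components of the Riemann curvature. -/
lemma scalarCurvature_eq {G : RiemMetric n M} {e : Fin n → VField n M} {U : Set M}
    (he : IsOrthonormalFrameOn G e U) {x : M} (hx : x ∈ U) :
    scalarCurvature G e x = ∑ i, ∑ j, riemannCoeff G e i j j i x := by
  refine Finset.sum_congr rfl fun i _ => Finset.sum_congr rfl fun j _ => ?_
  rw [curvature, map_sub, map_sub, sub_apply, sub_apply, he.inner_leviCivita_leviCivita hx,
    he.inner_leviCivita_leviCivita hx, he.inner_leviCivita_frame hx, riemannCoeff,
    Finset.sum_sub_distrib]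
  simp only [structureCoeff]
  ring

end Frame

/-! ### Clifford multiplication and matrices acting on spinors -/

section CliffordAction

lemma gen_mul_gen_add_swap {n : ℕ} (i j : Fin n) :
    (gen i * gen j + gen j * gen i : Cl n) = (if i = j then (-2 : ℝ) else 0) • 1 := by
  rw [gen, gen, CliffordAlgebra.ι_mul_ι_add_swap, ← Algebra.algebraMap_eq_smul_one]
  congr 1
  simp only [QuadraticMap.polar, negForm, QuadraticMap.weightedSumSquares_apply, Pi.add_apply,
    Pi.single_apply]
  rw [← Finset.sum_sub_distrib, ← Finset.sum_sub_distrib,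
    Finset.sum_eq_single i (fun k _ hk => by simp [hk]) (by simp)]
  rcases eq_or_ne i j with rfl | h
  · norm_num
  · simp [h]

variable {m : ℕ} {S : Type*} [NormedAddCommGroup S] [NormedSpace ℂ S] {N : ℕ}

lemma SpinorModule.finiteDimensional (σ : SpinorModule m S) : FiniteDimensional ℂ S :=
  Module.finite_of_finrank_pos (by rw [σ.finrank_eq]; positivity)

/-- Clifford multiplication `cliff σ i` as a real-linear endomorphism of `S ⊗ ℂ^N`. -/
noncomputable def cliffEnd (N : ℕ) (σ : SpinorModule m S) (i : Fin (2 * m + 1)) :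
    Module.End ℝ (Fin N → S) where
  toFun := cliff σ i
  map_add' v w := funext fun a => map_add (σ.rho (gen i)) (v a) (w a)
  map_smul' r v := funext fun a =>
    ((σ.rho (gen i)).restrictScalars ℝ).map_smul r (v a)

/-- The action `matAct A` of a matrix as a real-linear endomorphism of `S ⊗ ℂ^N`. -/
noncomputable def matEnd (S : Type*) [NormedAddCommGroup S] [NormedSpace ℂ S]
    (A : Matrix (Fin N) (Fin N) ℂ) : Module.End ℝ (Fin N → S) where
  toFun := matAct A
  map_add' v w := funext fun a => by
    simp only [matAct, Pi.add_apply, smul_add, Finset.sum_add_distrib]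
  map_smul' r v := funext fun a => by
    simp only [matAct, Pi.smul_apply, Finset.smul_sum, RingHom.id_apply, smul_comm r]

lemma cliffEnd_mul_add_swap (σ : SpinorModule m S) (i j : Fin (2 * m + 1)) :
    cliffEnd N σ i * cliffEnd N σ j + cliffEnd N σ j * cliffEnd N σ i =
      (if i = j then (-2 : ℝ) else 0) • 1 := by
  refine LinearMap.ext fun v => funext fun a => ?_
  have h := congrArg σ.rho (gen_mul_gen_add_swap i j)
  rw [map_add, map_mul, map_mul, map_smul, map_one] at h
  exact LinearMap.congr_fun h (v a)

lemma matAct_cliff (σ : SpinorModule m S) (A : Matrix (Fin N) (Fin N) ℂ) (i : Fin (2 * m + 1))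
    (v : Fin N → S) : matAct A (cliff σ i v) = cliff σ i (matAct A v) := by
  funext a
  simp only [matAct, cliff, map_sum, map_smul]

lemma matAct_mul (A B : Matrix (Fin N) (Fin N) ℂ) (v : Fin N → S) :
    matAct (A * B) v = matAct A (matAct B v) := by
  funext a
  simp only [matAct, Matrix.mul_apply, Finset.sum_smul, Finset.smul_sum, mul_smul]
  rw [Finset.sum_comm]

lemma matAct_one (v : Fin N → S) : matAct (1 : Matrix (Fin N) (Fin N) ℂ) v = v := by
  funext a
  simp [matAct, Matrix.one_apply]

/-- The action of matrices on `S ⊗ ℂ^N` is linear in the matrix. -/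
noncomputable def matActLinear (v : Fin N → S) : Matrix (Fin N) (Fin N) ℂ →ₗ[ℝ] (Fin N → S) where
  toFun A := matAct A v
  map_add' A B := funext fun a => by
    simp only [matAct, Matrix.add_apply, Pi.add_apply, add_smul, Finset.sum_add_distrib]
  map_smul' r A := funext fun a => by
    simp only [matAct, Matrix.smul_apply, Pi.smul_apply, smul_assoc, Finset.smul_sum,
      RingHom.id_apply]

end CliffordAction

section Calculus

variable {m : ℕ} {M : Type*} [TopologicalSpace M]
  [ChartedSpace (EuclideanSpace ℝ (Fin (2 * m + 1))) M]
  {S : Type*} [NormedAddCommGroup S] [NormedSpace ℂ S] {N : ℕ}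
  {ψ : M → Fin N → S} {x : M} {U : Set M}

lemma mvfderiv_pi_apply (hψ : MDifferentiableAt (𝓡 (2 * m + 1)) 𝓘(ℝ, Fin N → S) ψ x)
    (v : TangentSpace (𝓡 (2 * m + 1)) x) (a : Fin N) :
    mvfderiv (𝓡 (2 * m + 1)) ψ x v a = mvfderiv (𝓡 (2 * m + 1)) (fun y => ψ y a) x v :=
  (congrArg (fun L => L v) (mvfderiv_clm_comp
    (ContinuousLinearMap.proj (R := ℝ) (φ := fun _ : Fin N => S) a) hψ)).symm

lemma mvfderiv_end (σ : SpinorModule m S) (L : Module.End ℝ (Fin N → S))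
    (hψ : MDifferentiableAt (𝓡 (2 * m + 1)) 𝓘(ℝ, Fin N → S) ψ x)
    (v : TangentSpace (𝓡 (2 * m + 1)) x) :
    mvfderiv (𝓡 (2 * m + 1)) (fun y => L (ψ y)) x v = L (mvfderiv (𝓡 (2 * m + 1)) ψ x v) := by
  have := σ.finiteDimensional
  have : FiniteDimensional ℝ S := FiniteDimensional.complexToReal S
  exact congrArg (fun L => L v) (mvfderiv_clm_comp (LinearMap.toContinuousLinearMap L) hψ)

lemma ContMDiffOn.end_apply (σ : SpinorModule m S) (L : Module.End ℝ (Fin N → S))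
    (hψ : ContMDiffOn (𝓡 (2 * m + 1)) 𝓘(ℝ, Fin N → S) ∞ ψ U) :
    ContMDiffOn (𝓡 (2 * m + 1)) 𝓘(ℝ, Fin N → S) ∞ (fun y => L (ψ y)) U := by
  have := σ.finiteDimensional
  have : FiniteDimensional ℝ S := FiniteDimensional.complexToReal S
  exact (LinearMap.toContinuousLinearMap L).contMDiff.comp_contMDiffOn hψ

lemma ContMDiffOn.matAct {A : M → Matrix (Fin N) (Fin N) ℂ}
    (hψ : ContMDiffOn (𝓡 (2 * m + 1)) 𝓘(ℝ, Fin N → S) ∞ ψ U)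
    (hA : ∀ a b, ContMDiffOn (𝓡 (2 * m + 1)) 𝓘(ℝ, ℂ) ∞ (fun y => A y a b) U) :
    ContMDiffOn (𝓡 (2 * m + 1)) 𝓘(ℝ, Fin N → S) ∞ (fun y => matAct (A y) (ψ y)) U := by
  refine contMDiffOn_pi_space.2 fun a => ?_
  refine contMDiffOn_finsetSum fun b _ => ?_
  have h := contMDiffOn_pi_space.1 hψ b
  exact (ContinuousLinearMap.lsmul ℝ ℂ
    (E := S)).isBoundedBilinearMap.contDiff.contMDiff.comp_contMDiffOn ((hA a b).prodMk_space h)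

lemma mvfderiv_matAct {A : M → Matrix (Fin N) (Fin N) ℂ} (hU : IsOpen U)
    (hA : ∀ a b, ContMDiffOn (𝓡 (2 * m + 1)) 𝓘(ℝ, ℂ) ∞ (fun y => A y a b) U)
    (hψ : ContMDiffOn (𝓡 (2 * m + 1)) 𝓘(ℝ, Fin N → S) ∞ ψ U) (hx : x ∈ U)
    (X : VField (2 * m + 1) M) :
    mvfderiv (𝓡 (2 * m + 1)) (fun y => matAct (A y) (ψ y)) x (X x) =
      matAct (matDeriv A X x) (ψ x) + matAct (A x) (mvfderiv (𝓡 (2 * m + 1)) ψ x (X x)) := by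
  have hd : ∀ {F : Type _} [NormedAddCommGroup F] [NormedSpace ℝ F] {f : M → F},
      ContMDiffOn (𝓡 (2 * m + 1)) 𝓘(ℝ, F) ∞ f U →
      MDifferentiableAt (𝓡 (2 * m + 1)) 𝓘(ℝ, F) f x := fun hf =>
    ((hf x hx).contMDiffAt (hU.mem_nhds hx)).mdifferentiableAt (by simp)
  have hA' : ∀ a b, MDifferentiableAt (𝓡 (2 * m + 1)) 𝓘(ℝ, ℂ) (fun y => A y a b) x := fun a b =>
    ((hA a b x hx).contMDiffAt (hU.mem_nhds hx)).mdifferentiableAt (by simp)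
  have hψb := contMDiffOn_pi_space.1 hψ
  funext a
  rw [mvfderiv_pi_apply (hd (hψ.matAct hA)), Pi.add_apply]
  simp only [matAct]
  rw [mvfderiv_fun_sum, sum_apply, ← Finset.sum_add_distrib]
  · refine Finset.sum_congr rfl fun b _ => ?_
    rw [mvfderiv_pi_apply (hd hψ)]
    exact mvfderiv_bilinear (ContinuousLinearMap.lsmul ℝ ℂ (E := S)) (hA' a b) (hd (hψb b)) (X x)
  · exact fun b _ => hd ((ContinuousLinearMap.lsmul ℝ ℂ
      (E := S)).isBoundedBilinearMap.contDiff.contMDiff.comp_contMDiffOn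
      ((hA a b).prodMk_space (hψb b)))

end Calculus

/-! ### The spin connection and its curvature -/

section SpinConnection

variable {m : ℕ} {M : Type*} [TopologicalSpace M]
  [ChartedSpace (EuclideanSpace ℝ (Fin (2 * m + 1))) M] [IsManifold (𝓡 (2 * m + 1)) ∞ M]
  {S : Type*} [NormedAddCommGroup S] [NormedSpace ℂ S] {N : ℕ}
  {G : RiemMetric (2 * m + 1) M} {σ : SpinorModule m S}
  {e : Fin (2 * m + 1) → VField (2 * m + 1) M}
  {ψ : M → Fin N → S} {x : M} {U : Set M}

/-- The quadratic Clifford endomorphism `(1/4) ∑ⱼₖ aⱼₖ cⱼ cₖ` of a matrix `a`, as a linear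
function of `a`. -/
noncomputable def quadraticEnd (N : ℕ) (σ : SpinorModule m S) :
    (Fin (2 * m + 1) → Fin (2 * m + 1) → ℝ) →ₗ[ℝ] Module.End ℝ (Fin N → S) where
  toFun a := (1 / 4 : ℝ) • ∑ j, ∑ k, a j k • (cliffEnd N σ j * cliffEnd N σ k)
  map_add' a b := by
    simp only [Pi.add_apply, add_smul, Finset.sum_add_distrib, smul_add]
  map_smul' r a := by
    simp only [Pi.smul_apply, smul_assoc, ← Finset.smul_sum, RingHom.id_apply,
      smul_comm r (1 / 4 : ℝ)]

lemma quadraticEnd_apply (a : Fin (2 * m + 1) → Fin (2 * m + 1) → ℝ) (v : Fin N → S) :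
    quadraticEnd N σ a v = (1 / 4 : ℝ) • ∑ j, ∑ k, a j k • cliff σ j (cliff σ k v) := by
  simp only [quadraticEnd, LinearMap.coe_mk, AddHom.coe_mk, LinearMap.smul_apply,
    LinearMap.sum_apply]
  rfl

lemma spinConn_eq (X : VField (2 * m + 1) M) :
    spinConn G σ e X ψ x = mvfderiv (𝓡 (2 * m + 1)) ψ x (X x) +
      quadraticEnd N σ (fun j k => G.inner x (leviCivita G e X (e j) x) (e k x)) (ψ x) := by
  rw [quadraticEnd_apply]
  rfl

lemma spinConn_congr {φ : M → Fin N → S} (h : ψ =ᶠ[𝓝 x] φ) (X : VField (2 * m + 1) M) :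
    spinConn G σ e X ψ x = spinConn G σ e X φ x := by
  rw [spinConn_eq, spinConn_eq, mvfderiv_congr h, h.eq_of_nhds]

lemma spinConn_frame (he : IsOrthonormalFrameOn G e U) (hx : x ∈ U) (i : Fin (2 * m + 1)) :
    spinConn G σ e (e i) ψ x = mvfderiv (𝓡 (2 * m + 1)) ψ x (e i x) +
      quadraticEnd N σ (fun j k => leviCivitaCoeff G e i j k x) (ψ x) := by
  simp only [spinConn_eq, he.inner_leviCivita_frame_frame hx]

/-- The spin connection is tensorial in the direction of derivation. -/
lemma spinConn_eq_sum (he : IsOrthonormalFrameOn G e U) (hx : x ∈ U) (X : VField (2 * m + 1) M) :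
    spinConn G σ e X ψ x = ∑ i, G.inner x (X x) (e i x) • spinConn G σ e (e i) ψ x := by
  simp only [spinConn_frame he hx, spinConn_eq X, he.inner_leviCivita_frame hx, smul_add,
    Finset.sum_add_distrib, quadraticEnd_apply]
  congr 1
  · conv_lhs => rw [he.sum_inner_smul hx (X x)]
    simp only [map_sum, map_smul]
  · simp only [Finset.sum_smul, Finset.smul_sum, smul_smul]
    rw [← sum_cyclic fun j k i => ((1 / 4 : ℝ) * (G.inner x (X x) (e i x) *
      leviCivitaCoeff G e i j k x)) • cliff σ j (cliff σ k (ψ x))]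
    simp only [mul_left_comm]

lemma spinConn_sum (he : IsOrthonormalFrameOn G e U) (hx : x ∈ U) (X : VField (2 * m + 1) M)
    {κ : Type*} (s : Finset κ) {φ : κ → M → Fin N → S}
    (hφ : ∀ j ∈ s, ContMDiffOn (𝓡 (2 * m + 1)) 𝓘(ℝ, Fin N → S) ∞ (φ j) U) :
    spinConn G σ e X (fun y => ∑ j ∈ s, φ j y) x = ∑ j ∈ s, spinConn G σ e X (φ j) x := by
  simp only [spinConn_eq]
  rw [mvfderiv_fun_sum s fun j hj => he.mdifferentiableAt (hφ j hj) hx]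
  simp only [map_sum, sum_apply, Finset.sum_add_distrib]

lemma spinConn_add_smul (he : IsOrthonormalFrameOn G e U) (hx : x ∈ U) (X : VField (2 * m + 1) M)
    {φ : M → Fin N → S} (hψ : ContMDiffOn (𝓡 (2 * m + 1)) 𝓘(ℝ, Fin N → S) ∞ ψ U)
    (hφ : ContMDiffOn (𝓡 (2 * m + 1)) 𝓘(ℝ, Fin N → S) ∞ φ U) (u : ℝ) :
    spinConn G σ e X (fun y => ψ y + u • φ y) x =
      spinConn G σ e X ψ x + u • spinConn G σ e X φ x := by
  have h : mvfderiv (𝓡 (2 * m + 1)) (fun y => u • φ y) x =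
      u • mvfderiv (𝓡 (2 * m + 1)) φ x :=
    mvfderiv_clm_comp (u • ContinuousLinearMap.id ℝ (Fin N → S)) (he.mdifferentiableAt hφ hx)
  have hd : MDifferentiableAt (𝓡 (2 * m + 1)) 𝓘(ℝ, Fin N → S) (fun y => u • φ y) x :=
    he.mdifferentiableAt ((contDiff_const_smul u).contMDiff.comp_contMDiffOn hφ) hx
  simp only [spinConn_eq]
  rw [mvfderiv_fun_add (he.mdifferentiableAt hψ hx) hd, h, map_add, map_smul]
  simp only [add_apply, smul_apply]
  module

/-- Clifford multiplication is parallel. -/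
lemma spinConn_cliff (he : IsOrthonormalFrameOn G e U) (hx : x ∈ U)
    (hψ : ContMDiffOn (𝓡 (2 * m + 1)) 𝓘(ℝ, Fin N → S) ∞ ψ U) (i j : Fin (2 * m + 1)) :
    spinConn G σ e (e i) (fun y => cliff σ j (ψ y)) x =
      cliff σ j (spinConn G σ e (e i) ψ x) +
        ∑ k, leviCivitaCoeff G e i j k x • cliff σ k (ψ x) := by
  have h1 := mvfderiv_end σ (cliffEnd N σ j) (he.mdifferentiableAt hψ hx) (e i x)
  have h2 := LinearMap.congr_fun (quadratic_mul_gen (cliffEnd_mul_add_swap (N := N) σ)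
    (fun j k => leviCivitaCoeff G e i j k x) (fun j k => leviCivitaCoeff_swap G e i j k x) j) (ψ x)
  simp only [LinearMap.add_apply, LinearMap.sum_apply, LinearMap.smul_apply] at h2
  rw [spinConn_frame he hx, spinConn_frame he hx]
  change _ = cliffEnd N σ j _ + _
  rw [map_add, add_assoc, ← h1]
  exact congrArg _ h2

/-- The product rule for the spin connection and matrix-valued functions. -/
lemma spinConn_matAct (he : IsOrthonormalFrameOn G e U) (hx : x ∈ U)
    {A : M → Matrix (Fin N) (Fin N) ℂ}
    (hA : ∀ a b, ContMDiffOn (𝓡 (2 * m + 1)) 𝓘(ℝ, ℂ) ∞ (fun y => A y a b) U)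
    (hψ : ContMDiffOn (𝓡 (2 * m + 1)) 𝓘(ℝ, Fin N → S) ∞ ψ U) (X : VField (2 * m + 1) M) :
    spinConn G σ e X (fun y => matAct (A y) (ψ y)) x =
      matAct (matDeriv A X x) (ψ x) + matAct (A x) (spinConn G σ e X ψ x) := by
  rw [spinConn_eq, spinConn_eq, mvfderiv_matAct he.isOpen hA hψ hx, quadraticEnd_apply,
    quadraticEnd_apply]
  change _ = _ + matEnd S (A x) _
  simp only [map_add, map_sum, map_smul]
  simp only [matEnd, LinearMap.coe_mk, AddHom.coe_mk, matAct_cliff, add_assoc]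

/-- Smoothness and the product rule for quadratic Clifford endomorphisms with variable
coefficients. -/
lemma mvfderiv_quadraticEnd (he : IsOrthonormalFrameOn G e U) (hx : x ∈ U)
    {a : Fin (2 * m + 1) → Fin (2 * m + 1) → M → ℝ}
    (ha : ∀ j k, ContMDiffOn (𝓡 (2 * m + 1)) 𝓘(ℝ, ℝ) ∞ (a j k) U)
    (hψ : ContMDiffOn (𝓡 (2 * m + 1)) 𝓘(ℝ, Fin N → S) ∞ ψ U)
    (v : TangentSpace (𝓡 (2 * m + 1)) x) :
    ContMDiffOn (𝓡 (2 * m + 1)) 𝓘(ℝ, Fin N → S) ∞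
        (fun y => quadraticEnd N σ (fun j k => a j k y) (ψ y)) U ∧
    mvfderiv (𝓡 (2 * m + 1)) (fun y => quadraticEnd N σ (fun j k => a j k y) (ψ y)) x v =
      quadraticEnd N σ (fun j k => mvfderiv (𝓡 (2 * m + 1)) (a j k) x v) (ψ x) +
      quadraticEnd N σ (fun j k => a j k x) (mvfderiv (𝓡 (2 * m + 1)) ψ x v) := by
  have hcc : ∀ j k, ContMDiffOn (𝓡 (2 * m + 1)) 𝓘(ℝ, Fin N → S) ∞
      (fun y => cliff σ j (cliff σ k (ψ y))) U := fun j k =>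
    hψ.end_apply σ (cliffEnd N σ j * cliffEnd N σ k)
  have h1 : ∀ j k, ContMDiffOn (𝓡 (2 * m + 1)) 𝓘(ℝ, Fin N → S) ∞
      (fun y => a j k y • cliff σ j (cliff σ k (ψ y))) U := fun j k => (ha j k).smul (hcc j k)
  have h2 : ∀ j, ContMDiffOn (𝓡 (2 * m + 1)) 𝓘(ℝ, Fin N → S) ∞
      (fun y => ∑ k, a j k y • cliff σ j (cliff σ k (ψ y))) U := fun j =>
    contMDiffOn_finsetSum fun k _ => h1 j k
  have h3 : ContMDiffOn (𝓡 (2 * m + 1)) 𝓘(ℝ, Fin N → S) ∞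
      (fun y => ∑ j, ∑ k, a j k y • cliff σ j (cliff σ k (ψ y))) U :=
    contMDiffOn_finsetSum fun j _ => h2 j
  simp only [quadraticEnd_apply]
  refine ⟨(contDiff_const_smul (1 / 4 : ℝ)).contMDiff.comp_contMDiffOn h3, ?_⟩
  have h4 := congrArg (fun L => L v) (mvfderiv_clm_comp
    ((1 / 4 : ℝ) • ContinuousLinearMap.id ℝ (Fin N → S)) (he.mdifferentiableAt h3 hx))
  refine h4.trans ?_
  rw [mvfderiv_fun_sum _ fun j _ => he.mdifferentiableAt (h2 j) hx]
  simp only [ContinuousLinearMap.comp_apply, smul_apply, ContinuousLinearMap.id_apply, sum_apply]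
  rw [← smul_add, ← Finset.sum_add_distrib]
  congr 1
  refine Finset.sum_congr rfl fun j _ => ?_
  rw [mvfderiv_fun_sum _ fun k _ => he.mdifferentiableAt (h1 j k) hx, sum_apply,
    ← Finset.sum_add_distrib]
  refine Finset.sum_congr rfl fun k _ => ?_
  have h5 := mvfderiv_end σ (cliffEnd N σ j * cliffEnd N σ k) (he.mdifferentiableAt hψ hx) v
  rw [mvfderiv_fun_smul (he.mdifferentiableAt (ha j k) hx) (he.mdifferentiableAt (hcc j k) hx),
    add_apply]
  refine (add_comm _ _).trans ?_
  exact congrArg₂ (· + ·) rfl (congrArg (a j k x • ·) h5)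

lemma contMDiffOn_spinConn (he : IsOrthonormalFrameOn G e U)
    (hψ : ContMDiffOn (𝓡 (2 * m + 1)) 𝓘(ℝ, Fin N → S) ∞ ψ U) (i : Fin (2 * m + 1)) :
    ContMDiffOn (𝓡 (2 * m + 1)) 𝓘(ℝ, Fin N → S) ∞ (spinConn G σ e (e i) ψ) U := by
  intro x hx
  refine (((hψ.mvfderiv_apply he.isOpen (he.smooth i)).add
    (mvfderiv_quadraticEnd (σ := σ) he hx (fun j k => he.smooth_leviCivitaCoeff i j k) hψ
      (e i x)).1).congr fun y hy => spinConn_frame he hy i) x hx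

/-- The curvature of the spin connection is the Clifford action of the Riemann curvature. -/
lemma spinConn_curvature (he : IsOrthonormalFrameOn G e U) (hx : x ∈ U)
    (hψ : ContMDiffOn (𝓡 (2 * m + 1)) 𝓘(ℝ, Fin N → S) ∞ ψ U) (i j : Fin (2 * m + 1)) :
    spinConn G σ e (e i) (spinConn G σ e (e j) ψ) x -
      spinConn G σ e (e j) (spinConn G σ e (e i) ψ) x -
      ∑ k, structureCoeff G e i j k x • spinConn G σ e (e k) ψ x =
      quadraticEnd N σ (fun k l => riemannCoeff G e i j k l x) (ψ x) := by
  -- The second and the last term survive antisymmetrization in `i` and `j`; the first one leaves a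
  -- derivative along `[eᵢ, eⱼ]`.
  have key : ∀ i j, spinConn G σ e (e i) (spinConn G σ e (e j) ψ) x =
      mvfderiv (𝓡 (2 * m + 1)) (fun y => mvfderiv (𝓡 (2 * m + 1)) ψ y (e j y)) x (e i x) +
      quadraticEnd N σ (fun k l => mvfderiv (𝓡 (2 * m + 1)) (leviCivitaCoeff G e j k l) x (e i x))
        (ψ x) +
      quadraticEnd N σ (fun k l => leviCivitaCoeff G e j k l x)
        (mvfderiv (𝓡 (2 * m + 1)) ψ x (e i x)) +
      quadraticEnd N σ (fun k l => leviCivitaCoeff G e i k l x)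
        (mvfderiv (𝓡 (2 * m + 1)) ψ x (e j x)) +
      quadraticEnd N σ (fun k l => leviCivitaCoeff G e i k l x)
        (quadraticEnd N σ (fun k l => leviCivitaCoeff G e j k l x) (ψ x)) := by
    intro i j
    have hq := mvfderiv_quadraticEnd (σ := σ) he hx (fun k l => he.smooth_leviCivitaCoeff j k l)
      hψ (e i x)
    have h1 : spinConn G σ e (e j) ψ =ᶠ[𝓝 x] fun y => mvfderiv (𝓡 (2 * m + 1)) ψ y (e j y) +
        quadraticEnd N σ (fun k l => leviCivitaCoeff G e j k l y) (ψ y) := by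
      filter_upwards [he.isOpen.mem_nhds hx] with y hy
      exact spinConn_frame he hy j
    rw [spinConn_congr h1, spinConn_frame he hx, mvfderiv_fun_add
      (he.mdifferentiableAt (hψ.mvfderiv_apply he.isOpen (he.smooth j)) hx)
      (he.mdifferentiableAt hq.1 hx), add_apply, hq.2, map_add]
    abel
  have hcomm := he.mvfderiv_commutator hψ hx i j
  have hqq := LinearMap.congr_fun (quadratic_commutator (cliffEnd_mul_add_swap (N := N) σ)
    (fun k l => leviCivitaCoeff G e i k l x) (fun k l => leviCivitaCoeff G e j k l x)
    (fun k l => leviCivitaCoeff_swap G e i k l x)) (ψ x)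
  change quadraticEnd N σ _ (quadraticEnd N σ _ (ψ x)) =
    quadraticEnd N σ _ (quadraticEnd N σ _ (ψ x)) + quadraticEnd N σ _ (ψ x) at hqq
  have hR : quadraticEnd N σ (fun k l => riemannCoeff G e i j k l x) (ψ x) =
      quadraticEnd N σ (fun k l => mvfderiv (𝓡 (2 * m + 1)) (leviCivitaCoeff G e j k l) x (e i x))
        (ψ x)
      - quadraticEnd N σ (fun k l => mvfderiv (𝓡 (2 * m + 1)) (leviCivitaCoeff G e i k l) x (e j x))
        (ψ x)
      + quadraticEnd N σ (fun k l => ∑ a, (leviCivitaCoeff G e j k a x * leviCivitaCoeff G e i a l x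
        - leviCivitaCoeff G e i k a x * leviCivitaCoeff G e j a l x)) (ψ x)
      - ∑ a, structureCoeff G e i j a x •
        quadraticEnd N σ (fun k l => leviCivitaCoeff G e a k l x) (ψ x) := by
    have hf : (fun k l => riemannCoeff G e i j k l x) =
        (fun k l => mvfderiv (𝓡 (2 * m + 1)) (leviCivitaCoeff G e j k l) x (e i x))
        - (fun k l => mvfderiv (𝓡 (2 * m + 1)) (leviCivitaCoeff G e i k l) x (e j x))
        + (fun k l => ∑ a, (leviCivitaCoeff G e j k a x * leviCivitaCoeff G e i a l x
          - leviCivitaCoeff G e i k a x * leviCivitaCoeff G e j a l x))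
        - ∑ a, structureCoeff G e i j a x • fun k l => leviCivitaCoeff G e a k l x := by
      funext k l
      simp only [riemannCoeff, Pi.sub_apply, Pi.add_apply, Finset.sum_apply, Pi.smul_apply,
        smul_eq_mul]
    rw [hf, map_sub, map_add, map_sub, map_sum]
    simp only [map_smul, LinearMap.sub_apply, LinearMap.add_apply, LinearMap.sum_apply,
      LinearMap.smul_apply]
  rw [key i j, key j i, hqq, hR]
  simp only [spinConn_frame he hx, smul_add, Finset.sum_add_distrib, ← hcomm]
  abel

end SpinConnection

/-! ### The Dirac operator and its deformation -/

section CliffordOmega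

variable {m : ℕ} {M : Type*} [TopologicalSpace M]
  [ChartedSpace (EuclideanSpace ℝ (Fin (2 * m + 1))) M]
  {S : Type*} [NormedAddCommGroup S] [NormedSpace ℂ S] {N : ℕ}
  {σ : SpinorModule m S} {e : Fin (2 * m + 1) → VField (2 * m + 1) M}
  {ψ : M → Fin N → S} {x : M} {g : M → Matrix.unitaryGroup (Fin N) ℂ}

lemma cOmega_add_smul (φ : M → Fin N → S) (u : ℝ) :
    cOmega σ e g (fun y => ψ y + u • φ y) x = cOmega σ e g ψ x + u • cOmega σ e g φ x := by
  simp only [cOmega, Finset.smul_sum, ← Finset.sum_add_distrib]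
  refine Finset.sum_congr rfl fun i _ => ?_
  change cliffEnd N σ i (matEnd S _ _) =
    cliffEnd N σ i (matEnd S _ _) + u • cliffEnd N σ i (matEnd S _ _)
  simp only [map_add, map_smul]

/-- The operator `c(ω²)` is the square of `c(ω)`. -/
lemma cOmega_cOmega : cOmega σ e g (cOmega σ e g ψ) x = cOmegaSq σ e g ψ x := by
  refine Finset.sum_congr rfl fun i _ => ?_
  change cliffEnd N σ i (matEnd S _ (∑ j, _)) = _
  simp only [map_sum]
  refine Finset.sum_congr rfl fun j _ => ?_
  rw [matAct_mul]
  change cliff σ i (matAct _ (cliff σ j _)) = _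
  rw [matAct_cliff]

end CliffordOmega

section Dirac

variable {m : ℕ} {M : Type*} [TopologicalSpace M]
  [ChartedSpace (EuclideanSpace ℝ (Fin (2 * m + 1))) M] [IsManifold (𝓡 (2 * m + 1)) ∞ M]
  {S : Type*} [NormedAddCommGroup S] [NormedSpace ℂ S] {N : ℕ}
  {G : RiemMetric (2 * m + 1) M} {σ : SpinorModule m S}
  {e : Fin (2 * m + 1) → VField (2 * m + 1) M}
  {ψ : M → Fin N → S} {x : M} {U : Set M}

lemma dirac_congr {φ : M → Fin N → S} (h : ψ =ᶠ[𝓝 x] φ) :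
    dirac G σ e ψ x = dirac G σ e φ x := by
  simp only [dirac, spinConn_congr h]

lemma dirac_add_smul (he : IsOrthonormalFrameOn G e U) (hx : x ∈ U)
    {φ : M → Fin N → S} (hψ : ContMDiffOn (𝓡 (2 * m + 1)) 𝓘(ℝ, Fin N → S) ∞ ψ U)
    (hφ : ContMDiffOn (𝓡 (2 * m + 1)) 𝓘(ℝ, Fin N → S) ∞ φ U) (u : ℝ) :
    dirac G σ e (fun y => ψ y + u • φ y) x = dirac G σ e ψ x + u • dirac G σ e φ x := by
  simp only [dirac, spinConn_add_smul he hx _ hψ hφ, Finset.smul_sum, ← Finset.sum_add_distrib]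
  refine Finset.sum_congr rfl fun i _ => ?_
  change cliffEnd N σ i _ = cliffEnd N σ i _ + u • cliffEnd N σ i _
  rw [map_add, map_smul]

lemma contMDiffOn_dirac (he : IsOrthonormalFrameOn G e U)
    (hψ : ContMDiffOn (𝓡 (2 * m + 1)) 𝓘(ℝ, Fin N → S) ∞ ψ U) :
    ContMDiffOn (𝓡 (2 * m + 1)) 𝓘(ℝ, Fin N → S) ∞ (dirac G σ e ψ) U :=
  contMDiffOn_finsetSum fun i _ => (contMDiffOn_spinConn he hψ i).end_apply σ (cliffEnd N σ i)

/-- The Dirac operator applied to the Clifford contraction `∑ⱼ c(eʲ) φⱼ` of a spinor-valued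
one-form `φ` is the Clifford contraction of the covariant derivative of `φ`. -/
lemma dirac_sum_cliff (he : IsOrthonormalFrameOn G e U) (hx : x ∈ U)
    {φ : Fin (2 * m + 1) → M → Fin N → S}
    (hφ : ∀ j, ContMDiffOn (𝓡 (2 * m + 1)) 𝓘(ℝ, Fin N → S) ∞ (φ j) U) :
    dirac G σ e (fun y => ∑ j, cliff σ j (φ j y)) x =
      ∑ i, ∑ j, cliffEnd N σ i (cliffEnd N σ j (spinConn G σ e (e i) (φ j) x -
        ∑ k, leviCivitaCoeff G e i j k x • φ k x)) := by
  refine Finset.sum_congr rfl fun i _ => ?_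
  have hcφ : ∀ j, ContMDiffOn (𝓡 (2 * m + 1)) 𝓘(ℝ, Fin N → S) ∞
      (fun y => cliff σ j (φ j y)) U := fun j => (hφ j).end_apply σ (cliffEnd N σ j)
  rw [spinConn_sum he hx (e i) _ fun j _ => hcφ j]
  change cliffEnd N σ i _ = _
  rw [← map_sum]
  congr 1
  simp only [spinConn_cliff he hx (hφ _), map_sub, Finset.sum_add_distrib, Finset.sum_sub_distrib,
    map_sum, map_smul]
  rw [sub_eq_add_neg]
  congr 1
  rw [Finset.sum_comm, ← Finset.sum_neg_distrib]
  refine Finset.sum_congr rfl fun k _ => ?_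
  rw [← Finset.sum_neg_distrib]
  refine Finset.sum_congr rfl fun j _ => ?_
  -- The derivative of `c(eʲ)` carries `Γᵢⱼₖ c(eᵏ) φⱼ`; exchanging `j` and `k` costs a sign.
  rw [leviCivitaCoeff_swap, neg_smul]
  rfl

/-- The Lichnerowicz formula. -/
lemma dirac_dirac (he : IsOrthonormalFrameOn G e U) (hx : x ∈ U)
    (hψ : ContMDiffOn (𝓡 (2 * m + 1)) 𝓘(ℝ, Fin N → S) ∞ ψ U) :
    dirac G σ e (dirac G σ e ψ) x =
      -connLaplacian G σ e ψ x + (scalarCurvature G e x / 4) • ψ x := by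
  have h := dirac_sum_cliff (σ := σ) he hx (fun j => contMDiffOn_spinConn (σ := σ) he hψ j)
  refine h.trans ?_
  rw [sum_gen_gen_apply (cliffEnd_mul_add_swap σ)]
  congr 1
  · simp only [connLaplacian, spinConn_eq_sum he hx (leviCivita _ _ _ _),
      he.inner_leviCivita_frame_frame hx]
  · have hc : ∀ i j, spinConn G σ e (e i) (spinConn G σ e (e j) ψ) x -
        ∑ k, leviCivitaCoeff G e i j k x • spinConn G σ e (e k) ψ x -
        (spinConn G σ e (e j) (spinConn G σ e (e i) ψ) x -
        ∑ k, leviCivitaCoeff G e j i k x • spinConn G σ e (e k) ψ x) =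
        quadraticEnd N σ (fun k l => riemannCoeff G e i j k l x) (ψ x) := by
      intro i j
      rw [← spinConn_curvature he hx hψ]
      simp only [← leviCivitaCoeff_sub, sub_smul, Finset.sum_sub_distrib]
      abel
    simp only [hc]
    have hk := LinearMap.congr_fun (sum_curvature_gen (cliffEnd_mul_add_swap (N := N) σ)
      (fun i j k l => riemannCoeff G e i j k l x) (fun i j k l => riemannCoeff_swap G e i j k l x)
      (fun i j k l => riemannCoeff_swap' G e i j k l x)
      (fun i j k l => riemannCoeff_bianchi he hx i j k l)) (ψ x)
    rw [← scalarCurvature_eq he hx] at hk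
    simp only [LinearMap.sum_apply, LinearMap.smul_apply, Module.End.mul_apply,
      Module.End.one_apply] at hk
    simp only [quadraticEnd, LinearMap.coe_mk, AddHom.coe_mk, LinearMap.smul_apply,
      LinearMap.sum_apply, map_smul, map_sum, Module.End.mul_apply, ← Finset.smul_sum, hk]
    module

variable {g : M → Matrix.unitaryGroup (Fin N) ℂ}

/-- The form `ω` is tensorial. -/
lemma omega_eq_sum (he : IsOrthonormalFrameOn G e U) (hx : x ∈ U) (X : VField (2 * m + 1) M) :
    omega g X x = ∑ i, G.inner x (X x) (e i x) • omega g (e i) x := by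
  have h : matDeriv (fun y => (g y).val) X x =
      ∑ i, G.inner x (X x) (e i x) • matDeriv (fun y => (g y).val) (e i) x := by
    ext a b
    simp only [matDeriv, Matrix.sum_apply, Matrix.smul_apply]
    conv_lhs => rw [he.sum_inner_smul hx (X x)]
    simp only [map_sum, map_smul]
  simp only [omega, h, Finset.mul_sum, mul_smul_comm]

lemma contMDiffOn_omega (he : IsOrthonormalFrameOn G e U)
    (hg : ∀ a b, ContMDiff (𝓡 (2 * m + 1)) 𝓘(ℝ, ℂ) ∞ (fun x => (g x).val a b))
    (i : Fin (2 * m + 1)) (a b : Fin N) :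
    ContMDiffOn (𝓡 (2 * m + 1)) 𝓘(ℝ, ℂ) ∞ (fun y => omega g (e i) y a b) U := by
  simp only [omega, Matrix.mul_apply]
  refine contMDiffOn_finsetSum fun c _ => ?_
  have h1 : ContMDiffOn (𝓡 (2 * m + 1)) 𝓘(ℝ, ℂ) ∞
      (fun y => ((g y)⁻¹ : Matrix.unitaryGroup (Fin N) ℂ).val a c) U :=
    (Complex.conjCLE : ℂ →L[ℝ] ℂ).contMDiff.comp_contMDiffOn (hg c a).contMDiffOn
  have h2 := (hg c b).contMDiffOn.mvfderiv_apply he.isOpen (he.smooth i)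
  exact (ContinuousLinearMap.mul ℝ ℂ).isBoundedBilinearMap.contDiff.contMDiff.comp_contMDiffOn
    (h1.prodMk_space h2)

lemma contMDiffOn_cOmega (he : IsOrthonormalFrameOn G e U)
    (hg : ∀ a b, ContMDiff (𝓡 (2 * m + 1)) 𝓘(ℝ, ℂ) ∞ (fun x => (g x).val a b))
    (hψ : ContMDiffOn (𝓡 (2 * m + 1)) 𝓘(ℝ, Fin N → S) ∞ ψ U) :
    ContMDiffOn (𝓡 (2 * m + 1)) 𝓘(ℝ, Fin N → S) ∞ (cOmega σ e g ψ) U :=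
  contMDiffOn_finsetSum fun i _ => (hψ.matAct (contMDiffOn_omega he hg i)).end_apply σ
    (cliffEnd N σ i)

/-- Conjugating the Dirac operator by `g` adds `c(ω)`, hence `D_u = D + u c(ω)`. -/
lemma diracU_eq (he : IsOrthonormalFrameOn G e U) (hx : x ∈ U)
    (hg : ∀ a b, ContMDiff (𝓡 (2 * m + 1)) 𝓘(ℝ, ℂ) ∞ (fun x => (g x).val a b))
    (hψ : ContMDiffOn (𝓡 (2 * m + 1)) 𝓘(ℝ, Fin N → S) ∞ ψ U) (u : ℝ) :
    diracU G σ e g u ψ x = dirac G σ e ψ x + u • cOmega σ e g ψ x := by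
  have hinv : ((g x)⁻¹ : Matrix.unitaryGroup (Fin N) ℂ).val * (g x).val = 1 :=
    congrArg Subtype.val (inv_mul_cancel (g x))
  have h : matAct ((g x)⁻¹ : Matrix.unitaryGroup (Fin N) ℂ).val
      (dirac G σ e (fun y => matAct (g y).val (ψ y)) x) =
      dirac G σ e ψ x + cOmega σ e g ψ x := by
    simp only [dirac, cOmega, spinConn_matAct he hx (fun a b => (hg a b).contMDiffOn) hψ]
    change matEnd S _ _ = _
    rw [map_sum, ← Finset.sum_add_distrib]
    refine Finset.sum_congr rfl fun i _ => ?_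
    change matAct _ (cliff σ i _) = cliffEnd N σ i _ + cliffEnd N σ i _
    rw [matAct_cliff, ← map_add]
    change cliffEnd N σ i (matEnd S _ _) = _
    rw [map_add, add_comm]
    change cliffEnd N σ i (matAct _ (matAct _ _) + matAct _ (matAct _ _)) = _
    rw [← matAct_mul, ← matAct_mul, hinv, matAct_one]
    rfl
  rw [diracU, h]
  module

/-- The anticommutator of the Dirac operator with `c(ω)`. -/
lemma dirac_cOmega_add_cOmega_dirac (he : IsOrthonormalFrameOn G e U) (hx : x ∈ U)
    (hg : ∀ a b, ContMDiff (𝓡 (2 * m + 1)) 𝓘(ℝ, ℂ) ∞ (fun x => (g x).val a b))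
    (hψ : ContMDiffOn (𝓡 (2 * m + 1)) 𝓘(ℝ, Fin N → S) ∞ ψ U) :
    dirac G σ e (cOmega σ e g ψ) x + cOmega σ e g (dirac G σ e ψ) x =
      -((2 : ℝ) • contractOmega G σ e g ψ x) + cDOmega σ e g ψ x
        + matAct (codiffOmega G e g x) (ψ x) := by
  -- `B i j` is the covariant derivative `(∇_{eᵢ} ω)(eⱼ)`.
  set B : Fin (2 * m + 1) → Fin (2 * m + 1) → Matrix (Fin N) (Fin N) ℂ := fun i j =>
    matDeriv (omega g (e j)) (e i) x - ∑ k, leviCivitaCoeff G e i j k x • omega g (e k) x with hB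
  have h1 : dirac G σ e (cOmega σ e g ψ) x =
      ∑ i, ∑ j, cliffEnd N σ i (cliffEnd N σ j (matAct (B i j) (ψ x)))
      + ∑ i, ∑ j, cliffEnd N σ i (cliffEnd N σ j (matAct (omega g (e j) x)
        (spinConn G σ e (e i) ψ x))) := by
    refine (dirac_sum_cliff (σ := σ) he hx
      (fun j => hψ.matAct (contMDiffOn_omega he hg j))).trans ?_
    simp only [← Finset.sum_add_distrib, ← map_add]
    refine Finset.sum_congr rfl fun i _ => Finset.sum_congr rfl fun j _ => ?_
    rw [spinConn_matAct he hx (contMDiffOn_omega he hg j) hψ]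
    congr 2
    change _ = matActLinear (ψ x) (_ - _) + _
    rw [map_sub, map_sum, add_sub_right_comm]
    simp only [map_smul]
    rfl
  have h2 : cOmega σ e g (dirac G σ e ψ) x =
      ∑ i, ∑ j, cliffEnd N σ j (cliffEnd N σ i (matAct (omega g (e j) x)
        (spinConn G σ e (e i) ψ x))) := by
    rw [Finset.sum_comm]
    refine Finset.sum_congr rfl fun j _ => ?_
    change cliffEnd N σ j (matEnd S _ (∑ i, _)) = _
    simp only [map_sum]
    refine Finset.sum_congr rfl fun i _ => ?_
    congr 1
    exact matAct_cliff σ _ i _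
  have h3 : ∑ i, ∑ j, cliffEnd N σ i (cliffEnd N σ j (matAct (omega g (e j) x)
        (spinConn G σ e (e i) ψ x))) + ∑ i, ∑ j, cliffEnd N σ j (cliffEnd N σ i
        (matAct (omega g (e j) x) (spinConn G σ e (e i) ψ x))) =
      -((2 : ℝ) • contractOmega G σ e g ψ x) := by
    simp only [← Finset.sum_add_distrib, contractOmega, Finset.smul_sum, ← Finset.sum_neg_distrib]
    refine Finset.sum_congr rfl fun i _ => ?_
    have h : ∀ j v, cliffEnd N σ i (cliffEnd N σ j v) + cliffEnd N σ j (cliffEnd N σ i v) =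
        (if i = j then (-2 : ℝ) else 0) • v := fun j v =>
      LinearMap.congr_fun (cliffEnd_mul_add_swap σ i j) v
    simp only [h, ite_smul, zero_smul, Finset.sum_ite_eq, Finset.mem_univ, if_true, neg_smul]
  have h4 : ∑ i, ∑ j, cliffEnd N σ i (cliffEnd N σ j (matAct (B i j) (ψ x))) =
      matAct (codiffOmega G e g x) (ψ x) + cDOmega σ e g ψ x := by
    rw [sum_gen_gen_apply_Ioi (cliffEnd_mul_add_swap σ) fun i j => matAct (B i j) (ψ x)]
    congr 1
    · change -∑ i, matActLinear (ψ x) (B i i) = matActLinear (ψ x) _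
      rw [← map_sum, ← map_neg]
      congr 1
      simp only [codiffOmega, hB, omega_eq_sum he hx (leviCivita _ _ _ _),
        he.inner_leviCivita_frame_frame hx]
    · refine Finset.sum_congr rfl fun i _ => Finset.sum_congr rfl fun j _ => ?_
      change cliffEnd N σ i (cliffEnd N σ j (matActLinear (ψ x) _ - matActLinear (ψ x) _)) =
        cliffEnd N σ i (cliffEnd N σ j (matActLinear (ψ x) _))
      rw [← map_sub]
      congr 3
      have hs : ∀ k, G.inner x (mlieBracket (𝓡 (2 * m + 1)) (e i) (e j) x) (e k x) =
        structureCoeff G e i j k x := fun k => rfl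
      simp only [dOmega, hB, omega_eq_sum he hx (mlieBracket _ _ _), hs, ← leviCivitaCoeff_sub, sub_smul, Finset.sum_sub_distrib]
      abel
  rw [h1, h2, add_assoc, h3, h4]
  abel

end Dirac

theorem lemma4p1 {m : ℕ} (hm : 0 < m)
    {M : Type*} [TopologicalSpace M] [T2Space M] [CompactSpace M]
    [ChartedSpace (EuclideanSpace ℝ (Fin (2 * m + 1))) M] [IsManifold (𝓡 (2 * m + 1)) ∞ M]
    (G : RiemMetric (2 * m + 1) M) {ι : Type*} (P : SpinStructure G ι)
    {S : Type*} [NormedAddCommGroup S] [NormedSpace ℂ S] (σ : SpinorModule m S)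
    {N : ℕ} (g : M → Matrix.unitaryGroup (Fin N) ℂ)
    (hg : ∀ a b, ContMDiff (𝓡 (2 * m + 1)) 𝓘(ℝ, ℂ) ∞ (fun x => (g x).val a b))
    (u : ℝ) (ψ : SpinorField P σ N) (α : ι) (x : M) (hx : x ∈ P.dom α) :
    diracU G σ (P.frame α) g u (diracU G σ (P.frame α) g u (ψ.toFun α)) x =
      -connLaplacian G σ (P.frame α) (ψ.toFun α) x
        + (scalarCurvature G (P.frame α) x / 4) • ψ.toFun α x
        + u ^ 2 • cOmegaSq σ (P.frame α) g (ψ.toFun α) x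
        + u • (-((2 : ℝ) • contractOmega G σ (P.frame α) g (ψ.toFun α) x)
            + cDOmega σ (P.frame α) g (ψ.toFun α) x
            + matAct (codiffOmega G (P.frame α) g x) (ψ.toFun α x)) ∧
    HasDerivAt (fun t : ℝ => diracU G σ (P.frame α) g t (ψ.toFun α) x)
      (cOmega σ (P.frame α) g (ψ.toFun α) x) u := by
  have he : IsOrthonormalFrameOn G (P.frame α) (P.dom α) :=
    ⟨P.isOpen_dom α, P.frame_smooth α, P.orthonormal α⟩
  have hψ := ψ.smooth α
  have hDψ := contMDiffOn_dirac (σ := σ) he hψ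
  have hcψ := contMDiffOn_cOmega (σ := σ) he hg hψ
  constructor
  · have heq : ∀ y ∈ P.dom α, diracU G σ (P.frame α) g u (ψ.toFun α) y =
        dirac G σ (P.frame α) (ψ.toFun α) y + u • cOmega σ (P.frame α) g (ψ.toFun α) y :=
      fun y hy => diracU_eq he hy hg hψ u
    have hsm : ContMDiffOn (𝓡 (2 * m + 1)) 𝓘(ℝ, Fin N → S) ∞ (fun y =>
        dirac G σ (P.frame α) (ψ.toFun α) y + u • cOmega σ (P.frame α) g (ψ.toFun α) y)
        (P.dom α) := hDψ.add ((contDiff_const_smul u).contMDiff.comp_contMDiffOn hcψ)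
    have hev : diracU G σ (P.frame α) g u (ψ.toFun α) =ᶠ[𝓝 x] fun y =>
        dirac G σ (P.frame α) (ψ.toFun α) y + u • cOmega σ (P.frame α) g (ψ.toFun α) y := by
      filter_upwards [he.isOpen.mem_nhds hx] with y hy using heq y hy
    rw [diracU_eq he hx hg (hsm.congr heq), dirac_congr hev, dirac_add_smul he hx hDψ hcψ,
      dirac_dirac he hx hψ]
    have hcO : cOmega σ (P.frame α) g (diracU G σ (P.frame α) g u (ψ.toFun α)) x =
        cOmega σ (P.frame α) g (dirac G σ (P.frame α) (ψ.toFun α)) x +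
        u • cOmegaSq σ (P.frame α) g (ψ.toFun α) x := by
      rw [← cOmega_cOmega, ← cOmega_add_smul]
      simp only [cOmega, heq x hx]
    rw [hcO, ← dirac_cOmega_add_cOmega_dirac he hx hg hψ]
    module
  · simp only [diracU_eq he hx hg hψ]
    simpa using ((hasDerivAt_id u).smul_const (cOmega σ (P.frame α) g (ψ.toFun α) x)).const_add
      (dirac G σ (P.frame α) (ψ.toFun α) x)
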